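/- Let $(X,\mathcal B,\mu)$ be a standard non-atomic probability space, and let $\mathrm{Aut}=\mathrm{Aut}(X,\mathcal B,\mu)$ be the group of its invertible measure-preserving transformations, where transformations that coincide almost everywhere are identified. Equip $\mathrm{Aut}$ with the Halmos metric $$\rho(S,T)=\sum_{i\ge 0}2^{-i}\bigl(\mu(SA_i\,\triangle\, TA_i)+\mu(S^{-1}A_i\,\triangle\, T^{-1}A_i)\bigr),$$ where $(A_i)_{i\ge 0}$ is any sequence of measurable sets that is dense in $\mathcal B$ (for the pseudometric $\mu(A\triangle B)$). A set of transformations is called generic if it contains a dense $G_\delta$ subset of $(\mathrm{Aut},\rho)$. Denote the operator $f\mapsto f\circ T$ on the complex space $L_2(X,\mathcal B,\mu)$ again by $T$, and let $\Theta$ be the orthogonal projection of $L_2(X,\mathcal B,\mu)$ onto the constants. An admissible function is an expression $$Q(T)=a\,\Theta+\sum_{i\in\mathbb Z}a_iT^i,\qquad a\ge 0,\ a_i\ge 0,\ \sum_{i\in\mathbb Z} a_i=1-a .$$ Let $M\subset\mathbb N$ be an infinite set and let $Q,R$ be admissible functions. Then: (i) the set of $T\in\mathrm{Aut}$ for which there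 is an infinite subset $M'\subset M$ (depending on $T$) such that $T^m\to R(T)$ in the weak operator topology as $m\to\infty$, $m\in M'$, is generic; (ii) the set of $T\in\mathrm{Aut}$ such that $T^m\to Q(T)$ in the weak operator topology as $m\to\infty$, $m\in M$, is of first category in $(\mathrm{Aut},\rho)$. In particular, each of the following sets is generic: the set of weakly mixing transformations, i.e. those $T$ with $\frac1N\sum_{n=0}^{N-1}|\langle T^nf,g\rangle-\langle\Theta f,g\rangle|\to0$ for all $f,g\in L_2$; the set of transformations that are not mixing, i.e. for which $T^m\to\Theta$ weakly as $m\to\infty$ fails; and, for every $\kappa\in[0,1]$, the set of $\kappa$-mixing transformations, i.e. those $T$ for which $T^m\to\kappa\Theta+(1-\kappa)I$ weakly along some infinite set of positive integers $m\to\infty$. -/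

import Mathlib

open MeasureTheory Filter Topology
open scoped ENNReal symmDiff

noncomputable section

namespace WeakLimits

variable {X : Type*} [MeasurableSpace X]

/-- The group of bimeasurable bijections of `X` that preserve `μ`. -/
def mpPerm (μ : Measure X) : Subgroup (Equiv.Perm X) where
  carrier := {e | MeasurePreserving e μ μ ∧ MeasurePreserving e.symm μ μ}
  one_mem' := ⟨MeasurePreserving.id μ, MeasurePreserving.id μ⟩
  mul_mem' := fun ha hb => ⟨ha.1.comp hb.1, hb.2.comp ha.2⟩
  inv_mem' := fun ha => ⟨ha.2, ha.1⟩

theorem mpPerm.measurePreserving {μ : Measure X} (e : mpPerm μ) :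
    MeasurePreserving (e : Equiv.Perm X) μ μ := e.2.1

/-- The transformations that coincide with the identity almost everywhere. -/
def trivialPerm (μ : Measure X) : Subgroup (mpPerm μ) where
  carrier := {e | ∀ᵐ x ∂μ, (e : Equiv.Perm X) x = x}
  one_mem' := by
    change ∀ᵐ x ∂μ, ((1 : mpPerm μ) : Equiv.Perm X) x = x
    exact Eventually.of_forall fun _ => rfl
  mul_mem' := by
    intro a b ha hb
    change ∀ᵐ x ∂μ, (a : Equiv.Perm X) ((b : Equiv.Perm X) x) = x
    filter_upwards [b.2.1.quasiMeasurePreserving.ae ha, hb] with x h1 h2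
    exact h1.trans h2
  inv_mem' := by
    intro a ha
    change ∀ᵐ x ∂μ, (a : Equiv.Perm X).symm x = x
    filter_upwards [a.2.2.quasiMeasurePreserving.ae ha] with x hx
    have h : (a : Equiv.Perm X) ((a : Equiv.Perm X).symm x) = x := Equiv.apply_symm_apply _ x
    exact hx.symm.trans h

instance (μ : Measure X) : (trivialPerm μ).Normal where
  conj_mem := by
    intro n hn g
    change ∀ᵐ x ∂μ, (g : Equiv.Perm X) ((n : Equiv.Perm X) ((g : Equiv.Perm X).symm x)) = x
    filter_upwards [g.2.2.quasiMeasurePreserving.ae hn] with x hx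
    rw [hx]
    exact Equiv.apply_symm_apply _ x

/-- The group `Aut(X, μ)`: invertible measure-preserving transformations, where two
transformations that coincide almost everywhere are identified. -/
abbrev MPAut (μ : Measure X) : Type _ := mpPerm μ ⧸ trivialPerm μ

theorem ae_eq_of_rel {μ : Measure X} {S T : mpPerm μ}
    (h : QuotientGroup.leftRel (trivialPerm μ) S T) :
    ∀ᵐ x ∂μ, (S : Equiv.Perm X) x = (T : Equiv.Perm X) x := by
  have h' : ∀ᵐ x ∂μ, (S : Equiv.Perm X).symm ((T : Equiv.Perm X) x) = x :=
    QuotientGroup.leftRel_apply.1 h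
  filter_upwards [h'] with x hx
  exact ((Equiv.symm_apply_eq _).1 hx).symm

theorem rel_of_ae_eq {μ : Measure X} {S T : mpPerm μ}
    (h : ∀ᵐ x ∂μ, (S : Equiv.Perm X) x = (T : Equiv.Perm X) x) :
    QuotientGroup.leftRel (trivialPerm μ) S T := by
  refine QuotientGroup.leftRel_apply.2 ?_
  change ∀ᵐ x ∂μ, (S : Equiv.Perm X).symm ((T : Equiv.Perm X) x) = x
  filter_upwards [h] with x hx
  exact (Equiv.symm_apply_eq _).2 hx.symm

theorem ae_symm_eq {μ : Measure X} {S T : mpPerm μ}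
    (h : ∀ᵐ x ∂μ, (S : Equiv.Perm X) x = (T : Equiv.Perm X) x) :
    ∀ᵐ x ∂μ, (S : Equiv.Perm X).symm x = (T : Equiv.Perm X).symm x := by
  filter_upwards [T.2.2.quasiMeasurePreserving.ae h] with x hx
  rw [Equiv.symm_apply_eq, hx, Equiv.apply_symm_apply]

theorem image_ae_eq {μ : Measure X} {S T : mpPerm μ}
    (h : ∀ᵐ x ∂μ, (S : Equiv.Perm X) x = (T : Equiv.Perm X) x) (A : Set X) :
    ((S : Equiv.Perm X) '' A : Set X) =ᵐ[μ] ((T : Equiv.Perm X) '' A : Set X) := by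
  rw [Equiv.image_eq_preimage_symm, Equiv.image_eq_preimage_symm]
  filter_upwards [ae_symm_eq h] with x hx
  change A ((S : Equiv.Perm X).symm x) = A ((T : Equiv.Perm X).symm x)
  rw [hx]

/-- The number `μ(SA Δ TA)`. -/
def imageDist {μ : Measure X} (A : Set X) (S T : MPAut μ) : ℝ :=
  Quotient.liftOn₂' S T
    (fun S T : mpPerm μ => μ.real (((S : Equiv.Perm X) '' A) ∆ ((T : Equiv.Perm X) '' A)))
    (fun _ _ _ _ hS hT => congrArg ENNReal.toReal (measure_congr
      ((image_ae_eq (ae_eq_of_rel hS) A).symmDiff (image_ae_eq (ae_eq_of_rel hT) A))))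

/-- A sequence of measurable sets that is dense in the measure algebra of `μ`. -/
structure DenseFamily (μ : Measure X) where
  set : ℕ → Set X
  measurableSet : ∀ i, MeasurableSet (set i)
  dense : ∀ B : Set X, MeasurableSet B → ∀ ε : ℝ, 0 < ε → ∃ i, μ.real (set i ∆ B) < ε

section Metric

variable {μ : Measure X}

theorem imageDist_nonneg (A : Set X) (S T : MPAut μ) : 0 ≤ imageDist A S T := by
  induction S using Quotient.inductionOn'
  induction T using Quotient.inductionOn'
  exact measureReal_nonneg

theorem imageDist_self (A : Set X) (T : MPAut μ) : imageDist A T T = 0 := by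
  induction T using Quotient.inductionOn' with | h T => ?_
  change μ.real (((T : Equiv.Perm X) '' A) ∆ ((T : Equiv.Perm X) '' A)) = 0
  simp

theorem imageDist_comm (A : Set X) (S T : MPAut μ) : imageDist A S T = imageDist A T S := by
  induction S using Quotient.inductionOn' with | h S => ?_
  induction T using Quotient.inductionOn' with | h T => ?_
  change μ.real (((S : Equiv.Perm X) '' A) ∆ ((T : Equiv.Perm X) '' A)) =
    μ.real (((T : Equiv.Perm X) '' A) ∆ ((S : Equiv.Perm X) '' A))
  rw [symmDiff_comm]

variable [IsProbabilityMeasure μ]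

theorem imageDist_le_one (A : Set X) (S T : MPAut μ) : imageDist A S T ≤ 1 := by
  induction S using Quotient.inductionOn'
  induction T using Quotient.inductionOn'
  exact measureReal_le_one

theorem imageDist_triangle (A : Set X) (S T U : MPAut μ) :
    imageDist A S U ≤ imageDist A S T + imageDist A T U := by
  induction S using Quotient.inductionOn'
  induction T using Quotient.inductionOn'
  induction U using Quotient.inductionOn'
  exact measureReal_symmDiff_le _

/-- The Halmos distance
`ρ(S, T) = ∑ᵢ 2⁻ⁱ (μ(SAᵢ Δ TAᵢ) + μ(S⁻¹Aᵢ Δ T⁻¹Aᵢ))`. -/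
def halmosDist (D : DenseFamily μ) (S T : MPAut μ) : ℝ :=
  ∑' i : ℕ, (1 / 2 : ℝ) ^ i * (imageDist (D.set i) S T + imageDist (D.set i) S⁻¹ T⁻¹)

theorem summable_halmosDist (D : DenseFamily μ) (S T : MPAut μ) :
    Summable fun i : ℕ =>
      (1 / 2 : ℝ) ^ i * (imageDist (D.set i) S T + imageDist (D.set i) S⁻¹ T⁻¹) := by
  refine Summable.of_nonneg_of_le (fun i => ?_) (fun i => ?_)
    (summable_geometric_two.mul_right 2)
  · have := imageDist_nonneg (D.set i) S T
    have := imageDist_nonneg (D.set i) S⁻¹ T⁻¹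
    positivity
  · have h1 := imageDist_le_one (D.set i) S T
    have h2 := imageDist_le_one (D.set i) S⁻¹ T⁻¹
    gcongr
    linarith

theorem eq_of_imageDist_eq_zero [StandardBorelSpace X] (D : DenseFamily μ) (S T : MPAut μ)
    (h : ∀ i, imageDist (D.set i) S T = 0) : S = T := by
  induction S using Quotient.inductionOn' with | h S => ?_
  induction T using Quotient.inductionOn' with | h T => ?_
  refine Quotient.sound' (rel_of_ae_eq ?_)
  have key : ∀ B : Set X, MeasurableSet B →
      ((S : Equiv.Perm X) '' B : Set X) =ᵐ[μ] ((T : Equiv.Perm X) '' B : Set X) := by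
    intro B hB
    rw [← measure_symmDiff_eq_zero_iff, ← measureReal_eq_zero_iff]
    refine le_antisymm (le_of_forall_pos_le_add fun ε hε => ?_) measureReal_nonneg
    obtain ⟨i, hi⟩ := D.dense B hB (ε / 2) (half_pos hε)
    have tr : ∀ R : mpPerm μ,
        μ.real (((R : Equiv.Perm X) '' D.set i) ∆ ((R : Equiv.Perm X) '' B)) < ε / 2 := by
      intro R
      rw [Equiv.image_eq_preimage_symm, Equiv.image_eq_preimage_symm, ← Set.preimage_symmDiff,
        measureReal_def,
        R.2.2.measure_preimage ((D.measurableSet i).symmDiff hB).nullMeasurableSet]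
      exact hi
    have h0 : μ.real (((S : Equiv.Perm X) '' D.set i) ∆ ((T : Equiv.Perm X) '' D.set i)) = 0 := h i
    have h1 := tr S
    have h2 := tr T
    rw [symmDiff_comm] at h1
    have t1 := measureReal_symmDiff_le (μ := μ) (s := (S : Equiv.Perm X) '' B)
      (t := (S : Equiv.Perm X) '' D.set i) ((T : Equiv.Perm X) '' B)
    have t2 := measureReal_symmDiff_le (μ := μ) (s := (S : Equiv.Perm X) '' D.set i)
      (t := (T : Equiv.Perm X) '' D.set i) ((T : Equiv.Perm X) '' B)
    linarith
  have hs : ∀ᵐ x ∂μ, (S : Equiv.Perm X).symm x = (T : Equiv.Perm X).symm x := by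
    refine Filter.EventuallyEq.of_forall_separating_preimage (l := ae μ) MeasurableSet
      fun B hB => ?_
    have := key B hB
    rwa [Equiv.image_eq_preimage_symm, Equiv.image_eq_preimage_symm] at this
  filter_upwards [T.2.1.quasiMeasurePreserving.ae hs] with x hx
  rw [Equiv.symm_apply_apply, Equiv.symm_apply_eq] at hx
  exact hx.symm

/-- The metric space `(Aut(X, μ), ρ)`. -/
abbrev halmosMetric [StandardBorelSpace X] (D : DenseFamily μ) : MetricSpace (MPAut μ) where
  dist := halmosDist D
  dist_self T := by
    simp [halmosDist, imageDist_self]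
  dist_comm S T := by
    simp [halmosDist, imageDist_comm _ S T, imageDist_comm _ S⁻¹ T⁻¹]
  dist_triangle S T U := by
    rw [halmosDist, halmosDist, halmosDist,
      ← (summable_halmosDist D S T).tsum_add (summable_halmosDist D T U)]
    refine (summable_halmosDist D S U).tsum_le_tsum (fun i => ?_)
      ((summable_halmosDist D S T).add (summable_halmosDist D T U))
    rw [← mul_add]
    have h1 := imageDist_triangle (D.set i) S T U
    have h2 := imageDist_triangle (D.set i) S⁻¹ T⁻¹ U⁻¹
    refine mul_le_mul_of_nonneg_left ?_ (by positivity)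
    linarith
  eq_of_dist_eq_zero := by
    intro S T h
    replace h : halmosDist D S T = 0 := h
    refine eq_of_imageDist_eq_zero D S T fun i => ?_
    have hn : ∀ j, 0 ≤ (1 / 2 : ℝ) ^ j *
        (imageDist (D.set j) S T + imageDist (D.set j) S⁻¹ T⁻¹) := fun j => by
      have := imageDist_nonneg (D.set j) S T
      have := imageDist_nonneg (D.set j) S⁻¹ T⁻¹
      positivity
    have hi := congrFun (((summable_halmosDist D S T).hasSum_iff.2 h |>
      (hasSum_zero_iff_of_nonneg hn).1)) i
    have h1 := imageDist_nonneg (D.set i) S T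
    have h2 := imageDist_nonneg (D.set i) S⁻¹ T⁻¹
    have h3 : imageDist (D.set i) S T + imageDist (D.set i) S⁻¹ T⁻¹ = 0 :=
      (mul_eq_zero.1 hi).resolve_left (by positivity)
    linarith

/-- A set of transformations is generic if it contains a dense `G_δ` subset of
`(Aut(X, μ), ρ)`. -/
def IsGeneric [StandardBorelSpace X] (D : DenseFamily μ) (s : Set (MPAut μ)) : Prop :=
  letI := halmosMetric D
  ∃ W ⊆ s, IsGδ W ∧ Dense W

/-- A set of transformations of first category (meagre) in `(Aut(X, μ), ρ)`. -/
def IsFirstCategory [StandardBorelSpace X] (D : DenseFamily μ) (s : Set (MPAut μ)) : Prop :=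
  letI := halmosMetric D
  IsMeagre s

end Metric

/-- The complex Hilbert space `L₂(X, μ)`. -/
abbrev L2 (μ : Measure X) : Type _ := Lp ℂ 2 μ

/-- The operator on `L₂(X, μ)` induced by `T`, namely `f ↦ f ∘ T`. -/
def koopman {μ : Measure X} (T : MPAut μ) : L2 μ →L[ℂ] L2 μ :=
  Quotient.liftOn' T
    (fun T : mpPerm μ =>
      (Lp.compMeasurePreservingₗᵢ ℂ (T : Equiv.Perm X)
        (mpPerm.measurePreserving T)).toContinuousLinearMap)
    (by
      intro S T h
      ext1 f
      refine Lp.ext ?_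
      change Lp.compMeasurePreserving _ (mpPerm.measurePreserving S) f =ᵐ[μ]
        Lp.compMeasurePreserving _ (mpPerm.measurePreserving T) f
      filter_upwards [Lp.coeFn_compMeasurePreserving f (mpPerm.measurePreserving S),
        Lp.coeFn_compMeasurePreserving f (mpPerm.measurePreserving T), ae_eq_of_rel h]
        with x h1 h2 h3
      rw [h1, h2, Function.comp_apply, Function.comp_apply, h3])

/-- `Θ`, the orthogonal projection of `L₂(X, μ)` onto the constants. -/
def meanProj (μ : Measure X) [IsProbabilityMeasure μ] : L2 μ →L[ℂ] L2 μ :=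
  (Submodule.span ℂ {Lp.const 2 μ (1 : ℂ)}).starProjection

/-- The coefficients of an admissible function
`Q(T) = a Θ + ∑ᵢ aᵢ Tⁱ`, `a, aᵢ ≥ 0`, `∑ᵢ aᵢ = 1 - a`, `i ∈ ℤ`. -/
structure Admissible where
  a : ℝ
  coeff : ℤ → ℝ
  a_nonneg : 0 ≤ a
  coeff_nonneg : ∀ i, 0 ≤ coeff i
  hasSum : HasSum coeff (1 - a)

variable {μ : Measure X} [IsProbabilityMeasure μ]

/-- The operator `Q(T)`; the series converges absolutely in the operator norm. -/
def Admissible.eval (Q : Admissible) (T : MPAut μ) : L2 μ →L[ℂ] L2 μ :=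
  (Q.a : ℂ) • meanProj μ + ∑' i : ℤ, (Q.coeff i : ℂ) • koopman (T ^ i)

/-- `T^m → V` in the weak operator topology, as `m → ∞`, `m ∈ M`. -/
def WeakLimitAlong (M : Set ℕ) (T : MPAut μ) (V : L2 μ →L[ℂ] L2 μ) : Prop :=
  Tendsto (fun m : ℕ => ContinuousLinearMapWOT.ofCLM (koopman (T ^ m))) (atTop ⊓ 𝓟 M)
    (𝓝 (ContinuousLinearMapWOT.ofCLM V))

/-- Mixing: `T^m → Θ` weakly as `m → ∞`. -/
def IsMixing (T : MPAut μ) : Prop := WeakLimitAlong Set.univ T (meanProj μ)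

/-- Weak mixing: correlations tend to zero in the sense of Cesàro,
`(1/N) ∑_{n<N} |⟨Tⁿf, g⟩ - ⟨Θf, g⟩| → 0` for all `f, g ∈ L₂(X, μ)`. -/
def IsWeakMixing (T : MPAut μ) : Prop :=
  ∀ f g : L2 μ, Tendsto
    (fun N : ℕ => (N : ℝ)⁻¹ * ∑ n ∈ Finset.range N,
      ‖inner ℂ (koopman (T ^ n) f) g - inner ℂ (meanProj μ f) g‖) atTop (𝓝 0)

/-- `κ`-mixing: `T^m → κ Θ + (1 - κ) I` weakly along some sequence `m → ∞`. -/
def IsKappaMixing (κ : ℝ) (T : MPAut μ) : Prop :=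
  ∃ M : Set ℕ, M.Infinite ∧
    WeakLimitAlong M T ((κ : ℂ) • meanProj μ + ((1 - κ : ℝ) : ℂ) • ContinuousLinearMap.id ℂ (L2 μ))

end WeakLimits

end

/-! Call `T` good at level `k` if some `m ∈ M` with `m ≥ k` makes the correlations μ(T⁻ᵐAᵢ ∩ Aⱼ) of
the first sets of the dense family 1/(k+1)-close to those of R(T). Each good set is open, because
correlations are continuous in `T`. A `T` good at every level has R(T) as a weak limit inside `M`,
because the indicators of the Aᵢ span a dense subspace of L₂. Since ρ is complete
(`completeSpace_halmos`), Baire's theorem reduces (i) to the density of each good set.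

Density rests on `exists_approx`: for every T₀ and every large m there is a `T` near T₀ with Tᵐ
close to R(T₀). Choose finitely many exponents j that carry almost all of ∑ aⱼ. Give each j a cycle
of length m − j and weight aⱼ, and give the remaining weight to one cycle of length 2m. Let σ rotate
all cycles and carry along an untouched point (x, y) of X × X. At position p read off T₀ᵖx, except
in the second half of the long cycle, where T₀ᵖy is read. The read-out π has law μ, and π ∘ σ = T₀ ∘
π except at two positions per cycle at most. As m ≡ j mod m − j, rotating m times shifts the j-cycle
by j up to |j| wrap-arounds, which produces T₀ʲ. In the long cycle it exchanges the halves, so the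
independent points x and y are compared, which produces Θ.

The enlarged space is standard and non-atomic, hence isomorphic to X, and the isomorphism can be
made to match finitely many sets with their read-outs (`exists_isomorphism`). Conjugating σ by it
gives the required `T` (`exists_conjugate`, `exists_approx_of_perm`).

For (ii), (i) applied to I and to Θ shows that a generic `T` has both as limits inside `M`, so its
powers cannot converge along `M`. Non-mixing is proved the same way, and κ-mixing is a case of (i).
Weak mixing follows from having Θ as a limit along one subsequence, by a Bessel-type estimate
(`tendsto_average_norm_inner`). -/

noncomputable section

namespace WeakLimits

/-! ### The Halmos topology and continuity of the group operations -/

section ImageDist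

variable {X : Type*} [MeasurableSpace X] {μ : Measure X}

theorem imageDist_mk (A : Set X) (S T : mpPerm μ) :
    imageDist A (S : MPAut μ) (T : MPAut μ) =
      μ.real (((S : Equiv.Perm X) '' A) ∆ ((T : Equiv.Perm X) '' A)) := rfl

theorem imageDist_inv_mk (A : Set X) (S T : mpPerm μ) :
    imageDist A (S : MPAut μ)⁻¹ (T : MPAut μ)⁻¹ =
      μ.real (((S : Equiv.Perm X) ⁻¹' A) ∆ ((T : Equiv.Perm X) ⁻¹' A)) := by
  change μ.real (((S : Equiv.Perm X).symm '' A) ∆ ((T : Equiv.Perm X).symm '' A)) = _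
  rw [Equiv.image_symm_eq_preimage, Equiv.image_symm_eq_preimage]

theorem mpPerm.measurable (S : mpPerm μ) : Measurable (S : Equiv.Perm X) := S.2.1.measurable

theorem mpPerm.measurableSet_image (S : mpPerm μ) {A : Set X} (hA : MeasurableSet A) :
    MeasurableSet ((S : Equiv.Perm X) '' A) := by
  rw [Equiv.image_eq_preimage_symm]
  exact S.2.2.measurable hA

theorem mpPerm.measureReal_preimage (S : mpPerm μ) {A : Set X} (hA : MeasurableSet A) :
    μ.real ((S : Equiv.Perm X) ⁻¹' A) = μ.real A := by
  rw [measureReal_def, S.2.1.measure_preimage hA.nullMeasurableSet, measureReal_def]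

theorem mpPerm.measureReal_image (S : mpPerm μ) {A : Set X} (hA : MeasurableSet A) :
    μ.real ((S : Equiv.Perm X) '' A) = μ.real A := by
  rw [Equiv.image_eq_preimage_symm, measureReal_def,
    S.2.2.measure_preimage hA.nullMeasurableSet, measureReal_def]

theorem imageDist_mul_left {A : Set X} (hA : MeasurableSet A) (U S T : MPAut μ) :
    imageDist A (U * S) (U * T) = imageDist A S T := by
  induction U using Quotient.inductionOn' with | h U => ?_
  induction S using Quotient.inductionOn' with | h S => ?_
  induction T using Quotient.inductionOn' with | h T => ?_
  change μ.real ((((U * S : mpPerm μ) : Equiv.Perm X) '' A) ∆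
    (((U * T : mpPerm μ) : Equiv.Perm X) '' A)) =
    μ.real (((S : Equiv.Perm X) '' A) ∆ ((T : Equiv.Perm X) '' A))
  have h : ∀ V : mpPerm μ, ((U * V : mpPerm μ) : Equiv.Perm X) '' A =
      (U : Equiv.Perm X) '' ((V : Equiv.Perm X) '' A) := fun V => by
    rw [Set.image_image]; rfl
  rw [h, h, ← Set.image_symmDiff (U : Equiv.Perm X).injective, mpPerm.measureReal_image U]
  exact (mpPerm.measurableSet_image S hA).symmDiff (mpPerm.measurableSet_image T hA)

theorem imageDist_mul_right_mk (A : Set X) (S T : MPAut μ) (U : mpPerm μ) :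
    imageDist A (S * (U : MPAut μ)) (T * (U : MPAut μ)) =
      imageDist ((U : Equiv.Perm X) '' A) S T := by
  induction S using Quotient.inductionOn' with | h S => ?_
  induction T using Quotient.inductionOn' with | h T => ?_
  change μ.real ((((S * U : mpPerm μ) : Equiv.Perm X) '' A) ∆
    (((T * U : mpPerm μ) : Equiv.Perm X) '' A)) =
    μ.real (((S : Equiv.Perm X) '' ((U : Equiv.Perm X) '' A)) ∆
      ((T : Equiv.Perm X) '' ((U : Equiv.Perm X) '' A)))
  rw [Set.image_image, Set.image_image]
  rfl

/-- Applying `S` to S⁻¹A and T⁻¹A gives A = T(T⁻¹A) and S(T⁻¹A). So the inverse terms of ρ are image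
terms for another measurable set. -/
theorem imageDist_inv {A : Set X} (hA : MeasurableSet A) (S : MPAut μ) (T : mpPerm μ) :
    imageDist A S⁻¹ (T : MPAut μ)⁻¹ =
      imageDist ((T : Equiv.Perm X) ⁻¹' A) S (T : MPAut μ) := by
  have h1 := imageDist_mul_left hA S S⁻¹ (T : MPAut μ)⁻¹
  have h2 := imageDist_mul_right_mk A (T : MPAut μ) S T⁻¹
  have h3 : (((T⁻¹ : mpPerm μ) : Equiv.Perm X) '' A) = (T : Equiv.Perm X) ⁻¹' A :=
    Equiv.image_symm_eq_preimage _ _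
  have h4 : ((T⁻¹ : mpPerm μ) : MPAut μ) = (T : MPAut μ)⁻¹ := rfl
  rw [h3, h4, mul_inv_cancel] at h2
  rw [mul_inv_cancel] at h1
  rw [← h1, h2, imageDist_comm]

variable [IsProbabilityMeasure μ]

/-- Replacing `A` by `B` costs μ(A Δ B) twice, once under `S` and once under `T`. -/
theorem imageDist_le_add {A B : Set X} (hA : MeasurableSet A) (hB : MeasurableSet B)
    (S T : MPAut μ) : imageDist A S T ≤ imageDist B S T + 2 * μ.real (A ∆ B) := by
  induction S using Quotient.inductionOn' with | h S => ?_
  induction T using Quotient.inductionOn' with | h T => ?_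
  change μ.real (((S : Equiv.Perm X) '' A) ∆ ((T : Equiv.Perm X) '' A)) ≤
    μ.real (((S : Equiv.Perm X) '' B) ∆ ((T : Equiv.Perm X) '' B)) + 2 * μ.real (A ∆ B)
  have h : ∀ V : mpPerm μ, μ.real (((V : Equiv.Perm X) '' A) ∆ ((V : Equiv.Perm X) '' B)) =
      μ.real (A ∆ B) := fun V => by
    rw [← Set.image_symmDiff (V : Equiv.Perm X).injective, mpPerm.measureReal_image V (hA.symmDiff hB)]
  have h1 := measureReal_symmDiff_le (μ := μ) (s := (S : Equiv.Perm X) '' A)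
    (t := (S : Equiv.Perm X) '' B) ((T : Equiv.Perm X) '' A)
  have h2 := measureReal_symmDiff_le (μ := μ) (s := (S : Equiv.Perm X) '' B)
    (t := (T : Equiv.Perm X) '' B) ((T : Equiv.Perm X) '' A)
  have h3 := h S
  have h4 := h T
  rw [symmDiff_comm] at h4
  linarith

theorem imageDist_le_halmosDist (D : DenseFamily μ) (i : ℕ) (S T : MPAut μ) :
    imageDist (D.set i) S T ≤ 2 ^ i * halmosDist D S T := by
  have h := (summable_halmosDist D S T).le_tsum i fun j _ => by
    have := imageDist_nonneg (D.set j) S T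
    have := imageDist_nonneg (D.set j) S⁻¹ T⁻¹
    positivity
  have h0 := imageDist_nonneg (D.set i) S⁻¹ T⁻¹
  calc imageDist (D.set i) S T
      ≤ imageDist (D.set i) S T + imageDist (D.set i) S⁻¹ T⁻¹ := by linarith
    _ = 2 ^ i * ((1 / 2 : ℝ) ^ i *
          (imageDist (D.set i) S T + imageDist (D.set i) S⁻¹ T⁻¹)) := by
        rw [← mul_assoc, ← mul_pow]; norm_num
    _ ≤ _ := by gcongr; exact h

/-- On every measurable set, `ρ` controls `μ(SA Δ TA)` uniformly in `S` and `T`. -/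
theorem exists_imageDist_lt (D : DenseFamily μ) {A : Set X} (hA : MeasurableSet A) {ε : ℝ}
    (hε : 0 < ε) : ∃ δ > 0, ∀ S T : MPAut μ, halmosDist D S T < δ → imageDist A S T < ε := by
  obtain ⟨i, hi⟩ := D.dense A hA (ε / 4) (by positivity)
  refine ⟨ε / 2 / 2 ^ i, by positivity, fun S T h => ?_⟩
  have h1 := imageDist_le_add hA (D.measurableSet i) S T
  have h2 := imageDist_le_halmosDist D i S T
  rw [lt_div_iff₀' (by positivity)] at h
  rw [symmDiff_comm] at hi
  linarith

theorem tendsto_imageDist_of_dense (D : DenseFamily μ) {ι : Type*} {l : Filter ι}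
    {u : ι → MPAut μ} {T : MPAut μ}
    (h : ∀ i, Tendsto (fun a => imageDist (D.set i) (u a) T) l (𝓝 0)) {A : Set X}
    (hA : MeasurableSet A) : Tendsto (fun a => imageDist A (u a) T) l (𝓝 0) := by
  rw [Metric.tendsto_nhds]
  intro ε hε
  obtain ⟨i, hi⟩ := D.dense A hA (ε / 4) (by positivity)
  filter_upwards [(Metric.tendsto_nhds.1 (h i)) (ε / 2) (by positivity)] with a ha
  rw [Real.dist_0_eq_abs, abs_of_nonneg (imageDist_nonneg _ _ _)] at ha ⊢
  have h1 := imageDist_le_add hA (D.measurableSet i) (u a) T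
  rw [symmDiff_comm] at hi
  linarith

variable [StandardBorelSpace X]

theorem tendsto_imageDist (D : DenseFamily μ) {ι : Type*} {l : Filter ι} {u : ι → MPAut μ}
    {T : MPAut μ} (h : letI := halmosMetric D; Tendsto u l (𝓝 T)) {A : Set X}
    (hA : MeasurableSet A) : Tendsto (fun a => imageDist A (u a) T) l (𝓝 0) := by
  let := halmosMetric D
  rw [Metric.tendsto_nhds]
  intro ε hε
  obtain ⟨δ, hδ, H⟩ := exists_imageDist_lt D hA hε
  filter_upwards [(Metric.tendsto_nhds.1 h) δ hδ] with a ha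
  rw [Real.dist_0_eq_abs, abs_of_nonneg (imageDist_nonneg _ _ _)]
  exact H _ _ ha

/-- Only image terms need checking: the inverse terms reduce to them by `imageDist_inv`, and
dominated convergence passes to the sum. -/
theorem tendsto_halmos (D : DenseFamily μ) {ι : Type*} {l : Filter ι} {u : ι → MPAut μ}
    {T : MPAut μ} (h : ∀ i, Tendsto (fun a => imageDist (D.set i) (u a) T) l (𝓝 0)) :
    letI := halmosMetric D; Tendsto u l (𝓝 T) := by
  let := halmosMetric D
  rw [tendsto_iff_dist_tendsto_zero]
  have key : Tendsto (fun a => ∑' i : ℕ, (1 / 2 : ℝ) ^ i *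
      (imageDist (D.set i) (u a) T + imageDist (D.set i) (u a)⁻¹ T⁻¹)) l
      (𝓝 (∑' _ : ℕ, (0 : ℝ))) := by
    refine tendsto_tsum_of_dominated_convergence (summable_geometric_two.mul_right 2)
      (fun i => ?_) (Eventually.of_forall fun a i => ?_)
    · have h1 := h i
      have h2 : Tendsto (fun a => imageDist (D.set i) (u a)⁻¹ T⁻¹) l (𝓝 0) := by
        induction T using Quotient.inductionOn' with | h T => ?_
        have := tendsto_imageDist_of_dense D h (mpPerm.measurable T (D.measurableSet i))
        exact this.congr fun a => (imageDist_inv (D.measurableSet i) (u a) T).symm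
      simpa using (h1.add h2).const_mul ((1 / 2 : ℝ) ^ i)
    · have h1 := imageDist_nonneg (D.set i) (u a) T
      have h2 := imageDist_nonneg (D.set i) (u a)⁻¹ T⁻¹
      have h3 := imageDist_le_one (D.set i) (u a) T
      have h4 := imageDist_le_one (D.set i) (u a)⁻¹ T⁻¹
      rw [Real.norm_of_nonneg (by positivity)]
      gcongr
      linarith
  rw [tsum_zero] at key
  exact key

theorem tendsto_halmos_mul (D : DenseFamily μ) {ι : Type*} {l : Filter ι} {u v : ι → MPAut μ}
    {S T : MPAut μ} (hu : letI := halmosMetric D; Tendsto u l (𝓝 S))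
    (hv : letI := halmosMetric D; Tendsto v l (𝓝 T)) :
    letI := halmosMetric D; Tendsto (fun a => u a * v a) l (𝓝 (S * T)) := by
  refine tendsto_halmos D fun i => ?_
  induction T using Quotient.inductionOn' with | h T => ?_
  have h1 := tendsto_imageDist D hv (D.measurableSet i)
  have h2 := tendsto_imageDist D hu (mpPerm.measurableSet_image T (D.measurableSet i))
  refine squeeze_zero (fun a => imageDist_nonneg _ _ _) (fun a => ?_) (by simpa using h1.add h2)
  have h3 := imageDist_triangle (D.set i) (u a * v a) (u a * (T : MPAut μ)) (S * (T : MPAut μ))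
  rw [imageDist_mul_left (D.measurableSet i), imageDist_mul_right_mk] at h3
  exact h3

theorem tendsto_halmos_inv (D : DenseFamily μ) {ι : Type*} {l : Filter ι} {u : ι → MPAut μ}
    {T : MPAut μ} (hu : letI := halmosMetric D; Tendsto u l (𝓝 T)) :
    letI := halmosMetric D; Tendsto (fun a => (u a)⁻¹) l (𝓝 T⁻¹) := by
  refine tendsto_halmos D fun i => ?_
  induction T using Quotient.inductionOn' with | h T => ?_
  have := tendsto_imageDist D hu (mpPerm.measurable T (D.measurableSet i))
  exact this.congr fun a => (imageDist_inv (D.measurableSet i) (u a) T).symm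

theorem continuous_halmos_pow (D : DenseFamily μ) (n : ℕ) :
    letI := halmosMetric D; Continuous fun T : MPAut μ => T ^ n := by
  let := halmosMetric D
  induction n with
  | zero => simpa using continuous_const
  | succ n ih =>
    refine continuous_iff_continuousAt.2 fun T => ?_
    simp only [ContinuousAt, pow_succ]
    exact tendsto_halmos_mul D (ih.tendsto T) tendsto_id

theorem continuous_halmos_zpow (D : DenseFamily μ) (n : ℤ) :
    letI := halmosMetric D; Continuous fun T : MPAut μ => T ^ n := by
  let := halmosMetric D
  cases n with
  | ofNat n => simpa using continuous_halmos_pow D n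
  | negSucc n =>
    simp only [zpow_negSucc]
    exact continuous_iff_continuousAt.2 fun T =>
      tendsto_halmos_inv D ((continuous_halmos_pow D (n + 1)).tendsto T)

end ImageDist

/-! ### Correlations of sets as continuous functions of the transformation -/

section Corr

variable {X : Type*} [MeasurableSpace X] {μ : Measure X}

/-- The correlation `μ(T⁻¹A ∩ B)`. -/
def corr (A B : Set X) (T : MPAut μ) : ℝ :=
  Quotient.liftOn' T (fun T : mpPerm μ => μ.real (((T : Equiv.Perm X) ⁻¹' A) ∩ B)) (by
    intro S T h
    refine congrArg ENNReal.toReal (measure_congr ?_)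
    filter_upwards [ae_eq_of_rel h] with x hx
    change (A ((S : Equiv.Perm X) x) ∧ B x) = (A ((T : Equiv.Perm X) x) ∧ B x)
    rw [hx])

theorem corr_mk (A B : Set X) (T : mpPerm μ) :
    corr A B (T : MPAut μ) = μ.real (((T : Equiv.Perm X) ⁻¹' A) ∩ B) := rfl

theorem corr_nonneg (A B : Set X) (T : MPAut μ) : 0 ≤ corr A B T := by
  induction T using Quotient.inductionOn'
  exact measureReal_nonneg

variable [IsProbabilityMeasure μ]

theorem corr_le_one (A B : Set X) (T : MPAut μ) : corr A B T ≤ 1 := by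
  induction T using Quotient.inductionOn'
  exact measureReal_le_one

theorem abs_measureReal_sub_le_symmDiff (A B : Set X) (hA : NullMeasurableSet A μ)
    (hB : NullMeasurableSet B μ) : |μ.real A - μ.real B| ≤ μ.real (A ∆ B) :=
  abs_measureReal_sub_le_measureReal_symmDiff' hA hB (measure_ne_top _ _) (measure_ne_top _ _)

theorem abs_corr_sub_le {A B : Set X} (hA : MeasurableSet A) (hB : MeasurableSet B)
    (S T : MPAut μ) : |corr A B S - corr A B T| ≤ imageDist A S⁻¹ T⁻¹ := by
  induction S using Quotient.inductionOn' with | h S => ?_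
  induction T using Quotient.inductionOn' with | h T => ?_
  rw [show (Quotient.mk'' S : MPAut μ) = (S : MPAut μ) from rfl,
    show (Quotient.mk'' T : MPAut μ) = (T : MPAut μ) from rfl, imageDist_inv_mk, corr_mk, corr_mk]
  refine (abs_measureReal_sub_le_symmDiff _ _ ((mpPerm.measurable S hA).inter hB).nullMeasurableSet
    ((mpPerm.measurable T hA).inter hB).nullMeasurableSet).trans ?_
  rw [← Set.inter_symmDiff_distrib_right]
  exact measureReal_mono Set.inter_subset_left

theorem continuous_corr [StandardBorelSpace X] (D : DenseFamily μ) {A B : Set X}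
    (hA : MeasurableSet A) (hB : MeasurableSet B) :
    letI := halmosMetric D; Continuous (corr (μ := μ) A B) := by
  let := halmosMetric D
  refine continuous_iff_continuousAt.2 fun T => ?_
  rw [ContinuousAt, tendsto_iff_dist_tendsto_zero]
  refine squeeze_zero (fun _ => dist_nonneg) (fun S => abs_corr_sub_le hA hB S T) ?_
  exact tendsto_imageDist D (tendsto_halmos_inv D tendsto_id) hA

/-- The value `⟨Q(T) 1_A, 1_B⟩`. -/
def Admissible.corr (Q : Admissible) (A B : Set X) (T : MPAut μ) : ℝ :=
  Q.a * (μ.real A * μ.real B) + ∑' i : ℤ, Q.coeff i * WeakLimits.corr A B (T ^ i)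

theorem Admissible.summable_corr (Q : Admissible) (A B : Set X) (T : MPAut μ) :
    Summable fun i : ℤ => Q.coeff i * WeakLimits.corr A B (T ^ i) :=
  Summable.of_nonneg_of_le (fun i => mul_nonneg (Q.coeff_nonneg i) (corr_nonneg _ _ _))
    (fun i => mul_le_of_le_one_right (Q.coeff_nonneg i) (corr_le_one _ _ _)) Q.hasSum.summable

theorem Admissible.continuous_corr [StandardBorelSpace X] (D : DenseFamily μ) (Q : Admissible)
    {A B : Set X} (hA : MeasurableSet A) (hB : MeasurableSet B) :
    letI := halmosMetric D; Continuous (Q.corr (μ := μ) A B) := by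
  let := halmosMetric D
  refine continuous_const.add (continuous_tsum (fun i => continuous_const.mul
    ((WeakLimits.continuous_corr D hA hB).comp (continuous_halmos_zpow D i)))
    Q.hasSum.summable fun i T => ?_)
  rw [Real.norm_of_nonneg (mul_nonneg (Q.coeff_nonneg i) (corr_nonneg _ _ _))]
  exact mul_le_of_le_one_right (Q.coeff_nonneg i) (corr_le_one _ _ _)

end Corr

/-! ### Point maps from limits of set maps -/

section Realization

variable {X : Type*} [MeasurableSpace X] {μ : Measure X}

theorem ae_eq_of_preimage_ae_eq {Z : Type*} [MeasurableSpace Z] {ν : Measure Z}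
    [StandardBorelSpace X] {f g : Z → X}
    (h : ∀ A, MeasurableSet A → (f ⁻¹' A : Set Z) =ᵐ[ν] (g ⁻¹' A : Set Z)) : f =ᵐ[ν] g :=
  Filter.EventuallyEq.of_forall_separating_preimage (l := ae ν) MeasurableSet fun A hA => h A hA

/-- A pair of measure-preserving maps that are inverse to each other almost everywhere comes from
an invertible transformation. -/
theorem exists_mpPerm [StandardBorelSpace X] {T S : X → X} (hT : MeasurePreserving T μ μ)
    (hS : MeasurePreserving S μ μ) (hST : ∀ᵐ x ∂μ, S (T x) = x) (hTS : ∀ᵐ x ∂μ, T (S x) = x) :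
    ∃ e : mpPerm μ, (∀ᵐ x ∂μ, (e : Equiv.Perm X) x = T x) ∧
      ∀ᵐ x ∂μ, (e : Equiv.Perm X).symm x = S x := by
  classical
  set E : Set X := {x | S (T x) = x ∧ T (S x) = x} with hE
  have hEm : MeasurableSet E :=
    (measurableSet_eq_fun (hS.measurable.comp hT.measurable) measurable_id).inter
      (measurableSet_eq_fun (hT.measurable.comp hS.measurable) measurable_id)
  have hEae : ∀ᵐ x ∂μ, x ∈ E := by
    filter_upwards [hST, hTS] with x h1 h2 using ⟨h1, h2⟩
  -- The points whose forward orbits under both maps stay in `E` form a conull set that both maps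
  -- preserve. On it they are inverse bijections; off it the identity is used.
  set G : Set X := {x | ∀ n : ℕ, T^[n] x ∈ E ∧ S^[n] x ∈ E} with hG
  have hGm : MeasurableSet G := by
    have : G = ⋂ n : ℕ, (T^[n] ⁻¹' E ∩ S^[n] ⁻¹' E) := by
      ext x; simp [hG]
    rw [this]
    exact MeasurableSet.iInter fun n =>
      (hT.measurable.iterate n hEm).inter (hS.measurable.iterate n hEm)
  have hGae : ∀ᵐ x ∂μ, x ∈ G := by
    refine ae_all_iff.2 fun n => ?_
    filter_upwards [(hT.iterate n).quasiMeasurePreserving.ae hEae,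
      (hS.iterate n).quasiMeasurePreserving.ae hEae] with x h1 h2 using ⟨h1, h2⟩
  have hTG : ∀ x ∈ G, T x ∈ G := fun x hx n => by
    refine ⟨(hx (n + 1)).1, ?_⟩
    cases n with
    | zero => exact (hx 1).1
    | succ n =>
      rw [Function.iterate_succ_apply, show S (T x) = x from (hx 0).1.1]
      exact (hx n).2
  have hSG : ∀ x ∈ G, S x ∈ G := fun x hx n => by
    refine ⟨?_, (hx (n + 1)).2⟩
    cases n with
    | zero => exact (hx 1).2
    | succ n =>
      rw [Function.iterate_succ_apply, show T (S x) = x from (hx 0).1.2]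
      exact (hx n).1
  let e : Equiv.Perm X :=
    { toFun := fun x => if x ∈ G then T x else x
      invFun := fun x => if x ∈ G then S x else x
      left_inv := fun x => by
        by_cases hx : x ∈ G
        · simp only [hx, if_true, hTG x hx]
          exact (hx 0).1.1
        · simp only [hx, if_false]
      right_inv := fun x => by
        by_cases hx : x ∈ G
        · simp only [hx, if_true, hSG x hx]
          exact (hx 0).1.2
        · simp only [hx, if_false] }
  have he : ∀ᵐ x ∂μ, e x = T x := by
    filter_upwards [hGae] with x hx using if_pos hx
  have he' : ∀ᵐ x ∂μ, e.symm x = S x := by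
    filter_upwards [hGae] with x hx using if_pos hx
  have hem : Measurable e := Measurable.ite hGm hT.measurable measurable_id
  have hem' : Measurable e.symm := Measurable.ite hGm hS.measurable measurable_id
  exact ⟨⟨e, ⟨hem, by rw [Measure.map_congr he, hT.map_eq]⟩,
    ⟨hem', by rw [Measure.map_congr he', hS.map_eq]⟩⟩, he, he'⟩

variable [IsProbabilityMeasure μ]

theorem tendsto_measureReal_preimage_diff_accumulate {Y : Type*} [MeasurableSpace Y] {p : X → Y}
    (hp : Measurable p) {E : ℕ → Set Y} (hE : ∀ k, MeasurableSet (E k)) :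
    Tendsto (fun K => μ.real (p ⁻¹' (⋃ k, E k) \ p ⁻¹' (Set.accumulate E K))) atTop (𝓝 0) := by
  have h1 : Tendsto (fun K => μ.real (Set.accumulate (fun k => p ⁻¹' E k) K)) atTop
      (𝓝 (μ.real (⋃ k, p ⁻¹' E k))) :=
    (ENNReal.tendsto_toReal (measure_ne_top _ _)).comp tendsto_measure_iUnion_accumulate
  have h2 := h1.const_sub (μ.real (⋃ k, p ⁻¹' E k))
  rw [sub_self] at h2
  refine h2.congr fun K => ?_
  have h3 : p ⁻¹' (Set.accumulate E K) = Set.accumulate (fun k => p ⁻¹' E k) K := by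
    simp [Set.accumulate]
  rw [h3, Set.preimage_iUnion, measureReal_sdiff]
  · exact Set.iUnion₂_subset fun k _ => Set.subset_iUnion (fun k => p ⁻¹' E k) k
  · exact MeasurableSet.biUnion (Set.to_countable _) fun k _ => hp (hE k)

/-- The sets on which the preimages converge form a σ-algebra. Countable unions are truncated: the
tail under `f n` has the same measure for every `n`, since all `f n` carry `μ` to `ν`, so one
truncation serves all `n`. -/
theorem tendsto_symmDiff_of_generate {Y : Type*} [mY : MeasurableSpace Y] {ν : Measure Y}
    [IsProbabilityMeasure ν] {f : ℕ → X → Y} (hf : ∀ n, MeasurePreserving (f n) μ ν) {h : X → Y}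
    (hh : Measurable h) {s : Set (Set Y)}
    (hs : mY = MeasurableSpace.generateFrom s)
    (H : ∀ A ∈ s, Tendsto (fun n => μ.real ((f n ⁻¹' A) ∆ (h ⁻¹' A))) atTop (𝓝 0)) {A : Set Y}
    (hA : MeasurableSet A) :
    Tendsto (fun n => μ.real ((f n ⁻¹' A) ∆ (h ⁻¹' A))) atTop (𝓝 0) := by
  have hA' : MeasurableSet[MeasurableSpace.generateFrom s] A := hs ▸ hA
  induction A, hA' using MeasurableSpace.generateFrom_induction with
  | hC A hA' _ => exact H A hA'
  | empty => simp
  | compl A _ ih =>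
    refine (ih hA.of_compl).congr fun n => ?_
    rw [Set.preimage_compl, Set.preimage_compl, compl_symmDiff_compl]
  | iUnion E hE' ih =>
    have hE : ∀ k, MeasurableSet (E k) := fun k => by rw [hs]; exact hE' k
    set U := fun K => Set.accumulate E K with hU
    have hUm : ∀ K, MeasurableSet (U K) := fun K => MeasurableSet.biUnion (Set.to_countable _) fun k _ => hE k
    have hUt : ∀ K, Tendsto (fun n => μ.real ((f n ⁻¹' U K) ∆ (h ⁻¹' U K))) atTop (𝓝 0) := by
      intro K
      induction K with
      | zero => simpa [hU, Set.accumulate_zero_nat] using ih 0 (hE 0)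
      | succ K ihK =>
        refine squeeze_zero (fun _ => measureReal_nonneg) (fun n => ?_)
          (by simpa using ihK.add (ih (K + 1) (hE _)))
        refine (measureReal_mono ?_).trans (measureReal_union_le _ _)
        simp only [hU, Set.accumulate_succ, Set.preimage_union]
        exact Set.union_symmDiff_union_subset
    rw [Metric.tendsto_atTop]
    intro ε hε
    obtain ⟨K1, hK1⟩ := Metric.tendsto_atTop.1 (tendsto_measureReal_preimage_diff_accumulate (μ := μ) hh hE) (ε / 3) (by positivity)
    obtain ⟨K2, hK2⟩ := Metric.tendsto_atTop.1 (tendsto_measureReal_preimage_diff_accumulate (μ := ν) measurable_id hE) (ε / 3) (by positivity)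
    set K := max K1 K2
    obtain ⟨N, hN⟩ := Metric.tendsto_atTop.1 (hUt K) (ε / 3) (by positivity)
    refine ⟨N, fun n hn => ?_⟩
    have e1 := hK1 K (le_max_left _ _)
    have e2 := hK2 K (le_max_right _ _)
    have e3 := hN n hn
    rw [Real.dist_0_eq_abs, abs_of_nonneg measureReal_nonneg] at e1 e2 e3 ⊢
    have e4 : μ.real (f n ⁻¹' (⋃ k, E k) \ f n ⁻¹' (U K)) =
        ν.real (id ⁻¹' (⋃ k, E k) \ id ⁻¹' (U K)) := by
      rw [← Set.preimage_sdiff, measureReal_def, (hf n).measure_preimage, measureReal_def]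
      · rfl
      · exact ((MeasurableSet.iUnion hE).diff (hUm K)).nullMeasurableSet
    have sub : (f n ⁻¹' (⋃ k, E k)) ∆ (h ⁻¹' (⋃ k, E k)) ⊆
        ((f n ⁻¹' U K) ∆ (h ⁻¹' U K) ∪ (f n ⁻¹' (⋃ k, E k) \ f n ⁻¹' (U K))) ∪
          (h ⁻¹' (⋃ k, E k) \ h ⁻¹' (U K)) := by
      have hsub : U K ⊆ ⋃ k, E k := Set.iUnion₂_subset fun k _ => Set.subset_iUnion _ k
      intro x hx
      have i1 := @hsub (f n x)
      have i2 := @hsub (h x)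
      simp only [Set.mem_symmDiff, Set.mem_union, Set.mem_sdiff, Set.mem_preimage] at hx ⊢
      tauto
    have e5 := (measureReal_mono (μ := μ) sub).trans (measureReal_union_le _ _)
    have e6 := measureReal_union_le (μ := μ) ((f n ⁻¹' U K) ∆ (h ⁻¹' U K))
      (f n ⁻¹' (⋃ k, E k) \ f n ⁻¹' (U K))
    linarith

theorem measureReal_preimage_eq_of_tendsto {Y : Type*} [MeasurableSpace Y] {ν : Measure Y}
    {f : ℕ → X → Y} (hf : ∀ n, MeasurePreserving (f n) μ ν) {h : X → Y} (hh : Measurable h)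
    {A : Set Y} (hA : MeasurableSet A)
    (H : Tendsto (fun n => μ.real ((f n ⁻¹' A) ∆ (h ⁻¹' A))) atTop (𝓝 0)) :
    μ.real (h ⁻¹' A) = ν.real A := by
  have h1 : ∀ n, μ.real (f n ⁻¹' A) = ν.real A := fun n => by
    rw [measureReal_def, (hf n).measure_preimage hA.nullMeasurableSet, measureReal_def]
  have h2 : Tendsto (fun _ : ℕ => |ν.real A - μ.real (h ⁻¹' A)|) atTop (𝓝 0) := by
    refine squeeze_zero (fun _ => abs_nonneg _) (fun n => ?_) H
    rw [← h1 n]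
    exact abs_measureReal_sub_le_symmDiff _ _ ((hf n).measurable hA).nullMeasurableSet
      (hh hA).nullMeasurableSet
  have h3 := tendsto_nhds_unique tendsto_const_nhds h2
  rw [abs_eq_zero] at h3
  linarith

omit [IsProbabilityMeasure μ] in
-- Borel–Cantelli: if membership of `f n x` in `B` differs from eventual membership, it must change
-- at some step from `n` on, so the measure is at most a tail of the convergent series.
theorem tendsto_symmDiff_eventually_mem {f : ℕ → X → X} {B : Set X}
    (H : ∑' n, μ ((f n ⁻¹' B) ∆ (f (n + 1) ⁻¹' B)) ≠ ∞) :
    Tendsto (fun n => μ.real ((f n ⁻¹' B) ∆ {x | ∀ᶠ n in atTop, f n x ∈ B})) atTop (𝓝 0) := by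
  have h1 := ENNReal.tendsto_sum_nat_add _ H
  have h2 := (ENNReal.tendsto_toReal ENNReal.zero_ne_top).comp h1
  refine squeeze_zero (fun _ => measureReal_nonneg) (fun n => ?_) h2
  refine ENNReal.toReal_mono ?_ ?_
  · exact ((ENNReal.tsum_comp_le_tsum_of_injective (add_left_injective n) _).trans_lt
      (lt_top_iff_ne_top.2 H)).ne
  refine (measure_mono ?_).trans (measure_iUnion_le _)
  intro x hx
  by_contra hcon
  simp only [Set.mem_iUnion, not_exists, Set.mem_symmDiff, Set.mem_preimage] at hcon
  have hconst : ∀ k, f (k + n) x ∈ B ↔ f n x ∈ B := fun k => by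
    induction k with
    | zero => simp
    | succ k ih =>
      have := hcon k
      rw [show k + 1 + n = k + n + 1 by ring]
      tauto
  have : (∀ᶠ n in atTop, f n x ∈ B) ↔ f n x ∈ B := by
    constructor
    · intro hx
      obtain ⟨N, hN⟩ := eventually_atTop.1 hx
      exact (hconst N).1 (hN _ (by omega))
    · intro hx
      refine eventually_atTop.2 ⟨n, fun m hm => ?_⟩
      have := (hconst (m - n)).2 hx
      rwa [Nat.sub_add_cancel hm] at this
  rw [Set.mem_symmDiff, Set.mem_preimage, Set.mem_ofPred_eq, this] at hx
  tauto

theorem generateFrom_pi_prop :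
    (MeasurableSpace.pi : MeasurableSpace (ℕ → Prop)) =
      MeasurableSpace.generateFrom {E | ∃ i, E = {y | y i}} := by
  refine le_antisymm (iSup_le fun i => ?_) (MeasurableSpace.generateFrom_le ?_)
  · rw [MeasurableSpace.comap_le_iff_le_map]
    have : @Measurable _ _ (MeasurableSpace.generateFrom
        {E : Set (ℕ → Prop) | ∃ i, E = {y | y i}}) _ (fun y : ℕ → Prop => y i) :=
      (@measurableSet_setOfPred _ (_) _).1 (MeasurableSpace.measurableSet_generateFrom ⟨i, rfl⟩)
    exact measurable_iff_le_map.1 this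
  · rintro _ ⟨i, rfl⟩
    exact measurableSet_setOfPred.2 (measurable_pi_apply i)

/-- A sequence of measure-preserving maps that converges fast on the sets of a separating sequence
converges to a measure-preserving map. -/
theorem exists_limit_of_summable [StandardBorelSpace X] [Nonempty X] {f : ℕ → X → X}
    (hf : ∀ n, MeasurePreserving (f n) μ μ) {B : ℕ → Set X} (hB : ∀ i, MeasurableSet (B i))
    (hsep : Function.Injective fun x i => x ∈ B i)
    (H : ∀ i, ∑' n, μ ((f n ⁻¹' B i) ∆ (f (n + 1) ⁻¹' B i)) ≠ ∞) :
    ∃ g : X → X, MeasurePreserving g μ μ ∧ ∀ A, MeasurableSet A →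
      Tendsto (fun n => μ.real ((f n ⁻¹' A) ∆ (g ⁻¹' A))) atTop (𝓝 0) := by
  set ι : X → ℕ → Prop := fun x i => x ∈ B i with hι
  have hιm : Measurable ι := measurable_pi_iff.2 fun i => measurable_mem.2 (hB i)
  have hιe : MeasurableEmbedding ι := hιm.measurableEmbedding hsep
  have hCm : ∀ i, MeasurableSet {x | ∀ᶠ n in atTop, f n x ∈ B i} := fun i => by
    have : {x | ∀ᶠ n in atTop, f n x ∈ B i} = ⋃ N : ℕ, ⋂ n : ℕ, ⋂ _ : N ≤ n, f n ⁻¹' B i := by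
      ext x; simp [eventually_atTop]
    rw [this]
    exact MeasurableSet.iUnion fun N => MeasurableSet.iInter fun n => MeasurableSet.iInter fun _ =>
      (hf n).measurable (hB i)
  -- `h` is the limit of the codes `ι (f n x)`. It has the law of `ι`, hence lies in the range of
  -- `ι` almost everywhere and can be decoded to a point of `X`.
  set h : X → ℕ → Prop := fun x i => ∀ᶠ n in atTop, f n x ∈ B i with hh
  have hhm : Measurable h := measurable_pi_iff.2 fun i => measurableSet_setOfPred.1 (hCm i)
  have : IsProbabilityMeasure (μ.map ι) :=
    Measure.isProbabilityMeasure_map hιe.measurable.aemeasurable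
  have hιp : MeasurePreserving ι μ (μ.map ι) := ⟨hιe.measurable, rfl⟩
  have key : ∀ E : Set (ℕ → Prop), MeasurableSet E →
      Tendsto (fun n => μ.real (((ι ∘ f n) ⁻¹' E) ∆ (h ⁻¹' E))) atTop (𝓝 0) := by
    intro E hE
    refine tendsto_symmDiff_of_generate (fun n => hιp.comp (hf n)) hhm generateFrom_pi_prop ?_ hE
    rintro _ ⟨i, rfl⟩
    exact tendsto_symmDiff_eventually_mem (H i)
  obtain ⟨j, hj, hjι⟩ := hιe.exists_measurable_extend measurable_id (fun _ => inferInstance)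
  have hrange : ∀ᵐ x ∂μ, h x ∈ Set.range ι := by
    have h1 := measureReal_preimage_eq_of_tendsto (fun n => hιp.comp (hf n)) hhm
      hιe.measurableSet_range.compl (key _ hιe.measurableSet_range.compl)
    rw [map_measureReal_apply hιe.measurable hιe.measurableSet_range.compl] at h1
    have h2 : ι ⁻¹' (Set.range ι)ᶜ = ∅ := by ext; simp
    rw [h2, measureReal_empty, measureReal_eq_zero_iff] at h1
    exact h1
  have hg : ∀ A, MeasurableSet A →
      Tendsto (fun n => μ.real ((f n ⁻¹' A) ∆ ((j ∘ h) ⁻¹' A))) atTop (𝓝 0) := by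
    intro A hA
    refine (key _ (hιe.measurableSet_image.2 hA)).congr fun n => ?_
    rw [Set.preimage_comp, Set.preimage_image_eq _ hιe.injective]
    refine congrArg ENNReal.toReal (measure_congr ?_)
    refine (ae_eq_refl _).symmDiff ?_
    filter_upwards [hrange] with x hx
    obtain ⟨y, hy⟩ := hx
    have h1 : j (ι y) = y := congrFun hjι y
    apply propext
    change h x ∈ ι '' A ↔ j (h x) ∈ A
    rw [← hy, h1, hιe.injective.mem_set_image]
  refine ⟨j ∘ h, ⟨hj.comp hhm, ?_⟩, hg⟩
  ext A hA
  rw [Measure.map_apply (hj.comp hhm) hA,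
    ← ENNReal.toReal_eq_toReal_iff' (measure_ne_top _ _) (measure_ne_top _ _)]
  exact measureReal_preimage_eq_of_tendsto hf (hj.comp hhm) hA (hg A hA)

theorem exists_separating_seq (X : Type*) [MeasurableSpace X] [StandardBorelSpace X] :
    ∃ B : ℕ → Set X, (∀ i, MeasurableSet (B i)) ∧ Function.Injective fun x i => x ∈ B i := by
  refine ⟨MeasurableSpace.natGeneratingSequence X,
    MeasurableSpace.measurableSet_natGeneratingSequence, fun x y hxy => ?_⟩
  refine MeasurableSpace.injective_mapNatBool X (funext fun n => ?_)
  have := congrFun hxy n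
  simp only [eq_iff_iff] at this
  simp [MeasurableSpace.mapNatBool, this]

end Realization

/-! ### Completeness of the Halmos metric -/

section Complete

variable {X : Type*} [MeasurableSpace X] [StandardBorelSpace X] {μ : Measure X}
  [IsProbabilityMeasure μ]

/-- Compare the preimage of `A` under `g ∘ g'` with `A` through the preimage of g⁻¹A under the
inverse of `e n`. The first error is controlled by `h'`; invariance under `e n` turns the second
into the error in `h`. -/
theorem ae_leftInverse_of_tendsto {e : ℕ → mpPerm μ} {g g' : X → X}
    (hg : MeasurePreserving g μ μ)
    (h : ∀ A, MeasurableSet A →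
      Tendsto (fun n => μ.real (((e n : Equiv.Perm X) ⁻¹' A) ∆ (g ⁻¹' A))) atTop (𝓝 0))
    (h' : ∀ A, MeasurableSet A →
      Tendsto (fun n => μ.real (((e n : Equiv.Perm X).symm ⁻¹' A) ∆ (g' ⁻¹' A))) atTop (𝓝 0)) :
    ∀ᵐ x ∂μ, g (g' x) = x := by
  refine ae_eq_of_preimage_ae_eq (f := g ∘ g') (g := id) fun A hA => ?_
  rw [← measure_symmDiff_eq_zero_iff, ← measureReal_eq_zero_iff]
  have h1 := h' _ (hg.measurable hA)
  have h2 := h A hA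
  refine tendsto_nhds_unique (tendsto_const_nhds (f := atTop (α := ℕ))) (squeeze_zero
    (fun _ => measureReal_nonneg) (fun n => ?_) (by simpa using h1.add h2))
  have t := measureReal_symmDiff_le (μ := μ) (s := g' ⁻¹' (g ⁻¹' A))
    (t := (e n : Equiv.Perm X).symm ⁻¹' (g ⁻¹' A)) A
  have h3 : μ.real (((e n : Equiv.Perm X).symm ⁻¹' (g ⁻¹' A)) ∆ A) =
      μ.real (((e n : Equiv.Perm X) ⁻¹' A) ∆ (g ⁻¹' A)) := by
    have h4 : ((e n : Equiv.Perm X).symm ⁻¹' (g ⁻¹' A)) ∆ A =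
        (e n : Equiv.Perm X).symm ⁻¹' ((g ⁻¹' A) ∆ ((e n : Equiv.Perm X) ⁻¹' A)) := by
      rw [Set.preimage_symmDiff, ← Set.preimage_comp (f := (e n : Equiv.Perm X).symm)]
      simp
    rw [h4, symmDiff_comm (_ ⁻¹' A) (g ⁻¹' A)]
    exact mpPerm.measureReal_preimage (e n)⁻¹
      ((hg.measurable hA).symmDiff (mpPerm.measurable (e n) hA))
  rw [h3, symmDiff_comm (g' ⁻¹' _) ((e n : Equiv.Perm X).symm ⁻¹' _)] at t
  exact t

omit [StandardBorelSpace X] [IsProbabilityMeasure μ] in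
theorem halmosDist_inv (D : DenseFamily μ) (S T : MPAut μ) :
    halmosDist D S⁻¹ T⁻¹ = halmosDist D S T := by
  simp only [halmosDist, inv_inv, add_comm]

/-- A sequence that is Cauchy fast enough for ρ moves a separating sequence of sets summably, and so
does the sequence of inverses. Both then have measure-preserving limit maps, which invert each other
almost everywhere and so define an element of the group. -/
theorem completeSpace_halmos (D : DenseFamily μ) :
    @CompleteSpace (MPAut μ) (halmosMetric D).toUniformSpace := by
  let := halmosMetric D
  have : Nonempty X := μ.nonempty_of_neZero
  obtain ⟨B, hB, hsep⟩ := exists_separating_seq X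
  have hδ : ∀ N : ℕ, ∃ δ > 0, ∀ S T : MPAut μ, halmosDist D S T < δ →
      ∀ i ∈ Finset.range (N + 1), imageDist (B i) S T < (1 / 2) ^ N := fun N => by
    choose δ hδ H using fun i => exists_imageDist_lt D (hB i) (ε := (1 / 2) ^ N) (by positivity)
    refine ⟨(Finset.range (N + 1)).inf' ⟨0, by simp⟩ δ, ?_, fun S T h i hi => H i S T ?_⟩
    · exact (Finset.lt_inf'_iff _).2 fun i _ => hδ i
    · exact h.trans_le (Finset.inf'_le _ hi)
  choose δ hδ0 hδ using hδ
  have hlim : ∀ e : ℕ → mpPerm μ, (∀ N n m, N ≤ n → N ≤ m →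
      halmosDist D (e n : MPAut μ)⁻¹ (e m : MPAut μ)⁻¹ < δ N) →
      ∃ g : X → X, MeasurePreserving g μ μ ∧ ∀ A, MeasurableSet A →
        Tendsto (fun n => μ.real (((e n : Equiv.Perm X) ⁻¹' A) ∆ (g ⁻¹' A))) atTop (𝓝 0) := by
    intro e he
    refine exists_limit_of_summable (fun n => (e n).2.1) hB hsep fun i => ?_
    have hb : ∀ n, i ≤ n → μ (((e n : Equiv.Perm X) ⁻¹' B i) ∆ ((e (n + 1) : Equiv.Perm X) ⁻¹' B i))
        ≤ (1 / 2 : ℝ≥0∞) ^ n := fun n hn => by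
      have h1 := hδ n _ _ (he n n (n + 1) le_rfl n.le_succ) i
        (Finset.mem_range.2 (Nat.lt_succ_of_le hn))
      rw [imageDist_inv_mk] at h1
      have h2 : ENNReal.ofReal ((1 / 2 : ℝ) ^ n) = (1 / 2 : ℝ≥0∞) ^ n := by
        rw [ENNReal.ofReal_pow (by norm_num), ENNReal.ofReal_div_of_pos (by norm_num)]
        norm_num
      rw [← h2]
      exact ENNReal.le_ofReal_iff_toReal_le (measure_ne_top _ _) (by positivity) |>.2 h1.le
    -- The geometric bound is available only for `n ≥ i`; the factor `2 ^ i` covers the finitely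
    -- many earlier terms, each at most 1.
    have hb' : ∀ n, μ (((e n : Equiv.Perm X) ⁻¹' B i) ∆ ((e (n + 1) : Equiv.Perm X) ⁻¹' B i)) ≤
        2 ^ i * (1 / 2 : ℝ≥0∞) ^ n := fun n => by
      rcases le_total i n with hn | hn
      · exact (hb n hn).trans (le_mul_of_one_le_left' (one_le_pow₀ one_le_two))
      · refine prob_le_one.trans ?_
        calc (1 : ℝ≥0∞) = 2 ^ i * (1 / 2 : ℝ≥0∞) ^ i := by
              rw [← mul_pow, ENNReal.mul_div_cancel two_ne_zero ENNReal.ofNat_ne_top, one_pow]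
          _ ≤ _ := mul_le_mul_right (pow_le_pow_of_le_one (by simp) (by simp) hn) _
    refine ((ENNReal.tsum_le_tsum hb').trans_lt ?_).ne
    rw [ENNReal.tsum_mul_left, ENNReal.tsum_geometric]
    refine ENNReal.mul_lt_top (by finiteness) ?_
    simp
  refine Metric.complete_of_convergent_controlled_sequences δ hδ0 fun u hu => ?_
  set e : ℕ → mpPerm μ := fun n => (u n).out with he
  have hue : ∀ n, (e n : MPAut μ) = u n := fun n => Quotient.out_eq' _
  obtain ⟨g, hg, hgt⟩ := hlim e fun N n m hn hm => by
    rw [hue, hue, halmosDist_inv]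
    exact hu N n m hn hm
  obtain ⟨g', hg', hgt'⟩ := hlim (fun n => (e n)⁻¹) fun N n m hn hm => by
    rw [QuotientGroup.mk_inv, QuotientGroup.mk_inv, inv_inv, inv_inv, hue, hue]
    exact hu N n m hn hm
  obtain ⟨s, hs1, hs2⟩ := exists_mpPerm hg hg' (ae_leftInverse_of_tendsto (e := fun n => (e n)⁻¹)
    hg' hgt' hgt) (ae_leftInverse_of_tendsto hg hgt hgt')
  refine ⟨(s : MPAut μ), tendsto_halmos D fun i => ?_⟩
  refine (hgt' _ (D.measurableSet i)).congr fun n => ?_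
  rw [← hue n, imageDist_mk]
  rw [Equiv.image_eq_preimage_symm, Equiv.image_eq_preimage_symm]
  refine congrArg ENNReal.toReal (measure_congr ((ae_eq_refl _).symmDiff ?_))
  filter_upwards [hs2] with x hx
  change D.set i (g' x) = D.set i _
  rw [hx]

end Complete

/-! ### Monotone transport between continuous laws on the line -/

section CDF

open ProbabilityTheory Set

theorem continuous_cdf (ν : Measure ℝ) [IsProbabilityMeasure ν] [NullSingletonClass ν] :
    Continuous (cdf ν) := by
  refine continuous_iff_continuousAt.2 fun x => ?_
  rw [(monotone_cdf ν).continuousAt_iff_leftLim_eq_rightLim, StieltjesFunction.rightLim_eq]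
  have h : ν {x} = 0 := measure_singleton x
  rw [← measure_cdf ν, StieltjesFunction.measure_singleton, ENNReal.ofReal_eq_zero] at h
  exact le_antisymm ((monotone_cdf ν).leftLim_le le_rfl) (by linarith)

/-- The distribution function of a continuous law is uniformly distributed. -/
theorem measureReal_cdf_le (ν : Measure ℝ) [IsProbabilityMeasure ν] [NullSingletonClass ν] {u : ℝ}
    (h0 : 0 ≤ u) (h1 : u ≤ 1) : ν.real {z | cdf ν z ≤ u} = u := by
  rcases h1.eq_or_lt with rfl | h1
  · simp [cdf_le_one]
  rcases Set.eq_empty_or_nonempty {z | cdf ν z ≤ u} with he | hne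
  · rw [he, measureReal_empty]
    refine le_antisymm h0 (ge_of_tendsto' (tendsto_cdf_atBot ν) fun z => ?_)
    by_contra hz
    exact (he ▸ (not_le.1 hz).le : z ∈ (∅ : Set ℝ))
  · have hbdd : BddAbove {z | cdf ν z ≤ u} := by
      obtain ⟨b, hb⟩ := ((tendsto_cdf_atTop ν).eventually (lt_mem_nhds h1)).exists
      refine ⟨b, fun z hz => le_of_not_gt fun hbz => ?_⟩
      exact absurd (hb.trans_le (monotone_cdf ν hbz.le)) (not_lt.2 hz)
    have hcl : IsClosed {z | cdf ν z ≤ u} := isClosed_le (continuous_cdf ν) continuous_const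
    set s := sSup {z | cdf ν z ≤ u} with hs
    have hmem : cdf ν s ≤ u := hcl.csSup_mem hne hbdd
    have heq : {z | cdf ν z ≤ u} = Iic s := by
      ext z
      exact ⟨fun hz => le_csSup hbdd hz, fun hz => (monotone_cdf ν hz).trans hmem⟩
    rw [heq, ← cdf_eq_real]
    refine le_antisymm hmem ?_
    refine ge_of_tendsto ((continuous_cdf ν).continuousWithinAt (s := Ioi s) (x := s)) ?_
    filter_upwards [self_mem_nhdsWithin] with z hz
    by_contra hlt
    exact not_lt.2 (le_csSup hbdd (not_le.1 hlt).le) hz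

theorem ae_cdf_mem_Ioo (ν : Measure ℝ) [IsProbabilityMeasure ν] [NullSingletonClass ν] :
    ∀ᵐ z ∂ν, cdf ν z ∈ Ioo 0 1 := by
  have hm : ∀ u, MeasurableSet {z | cdf ν z ≤ u} := fun u =>
    (isClosed_le (continuous_cdf ν) continuous_const).measurableSet
  have h0 : ∀ᵐ z ∂ν, 0 < cdf ν z := by
    have := measureReal_cdf_le ν le_rfl zero_le_one
    rw [measureReal_eq_zero_iff] at this
    filter_upwards [measure_eq_zero_iff_ae_notMem.1 this] with z hz using not_le.1 hz
  have h1 : ∀ᵐ z ∂ν, cdf ν z < 1 := by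
    have hle : ∀ u : ℝ, 0 ≤ u → u < 1 → ν.real {z | 1 ≤ cdf ν z} ≤ 1 - u := fun u hu hu1 => by
      have h2 := probReal_compl_eq_one_sub (μ := ν) (hm u)
      rw [measureReal_cdf_le ν hu hu1.le] at h2
      rw [← h2]
      exact measureReal_mono fun z (hz : 1 ≤ cdf ν z) => not_le.2 (hu1.trans_le hz)
    have h3 : ν.real {z | 1 ≤ cdf ν z} = 0 := by
      refine le_antisymm (le_of_forall_pos_le_add fun ε hε => ?_) measureReal_nonneg
      rcases le_total ε 1 with h | h
      · linarith [hle (1 - ε) (by linarith) (by linarith)]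
      · linarith [hle 0 le_rfl one_pos]
    rw [measureReal_eq_zero_iff] at h3
    filter_upwards [measure_eq_zero_iff_ae_notMem.1 h3] with z hz using not_le.1 hz
  filter_upwards [h0, h1] with z hz0 hz1 using ⟨hz0, hz1⟩

open Classical in
/-- The monotone map that carries the law `ν` to the law `κ`. -/
def monotoneTransport (ν κ : Measure ℝ) (z : ℝ) : ℝ :=
  -- When `cdf ν z` is 0 or 1, the set may be unbounded below or empty. This happens on a `ν`-null
  -- set if `ν` is a probability measure without atoms, so the default 0 is harmless.
  if cdf ν z ∈ Ioo 0 1 then sInf {t | cdf ν z ≤ cdf κ t} else 0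

variable (ν κ : Measure ℝ) [IsProbabilityMeasure κ] [NullSingletonClass κ]

omit [IsProbabilityMeasure κ] [NullSingletonClass κ] in
theorem bddBelow_cdf_le {u : ℝ} (hu : u ∈ Ioo (0 : ℝ) 1) : BddBelow {t | u ≤ cdf κ t} := by
  obtain ⟨b, hb⟩ := ((tendsto_cdf_atBot κ).eventually (gt_mem_nhds hu.1)).exists
  refine ⟨b, fun t ht => le_of_not_gt fun hbt => ?_⟩
  exact absurd ((monotone_cdf κ hbt.le).trans_lt hb) (not_lt.2 ht)

theorem cdf_monotoneTransport {z : ℝ} (hz : cdf ν z ∈ Ioo 0 1) :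
    cdf κ (monotoneTransport ν κ z) = cdf ν z := by
  rw [monotoneTransport, if_pos hz]
  have hbdd := bddBelow_cdf_le κ hz
  have hne : {t | cdf ν z ≤ cdf κ t}.Nonempty :=
    (((tendsto_cdf_atTop κ).eventually (lt_mem_nhds hz.2)).mono fun _ h => h.le).exists
  have hcl : IsClosed {t | cdf ν z ≤ cdf κ t} := isClosed_le continuous_const (continuous_cdf κ)
  refine le_antisymm ?_ (hcl.csInf_mem hne hbdd)
  refine le_of_tendsto ((continuous_cdf κ).continuousWithinAt
    (s := Iio (sInf {t | cdf ν z ≤ cdf κ t})) (x := sInf {t | cdf ν z ≤ cdf κ t})) ?_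
  filter_upwards [self_mem_nhdsWithin] with t ht
  by_contra hlt
  exact not_lt.2 (csInf_le hbdd (not_le.1 hlt).le) ht

theorem monotoneTransport_le_iff {z : ℝ} (hz : cdf ν z ∈ Ioo 0 1) (t : ℝ) :
    monotoneTransport ν κ z ≤ t ↔ cdf ν z ≤ cdf κ t := by
  constructor
  · intro h
    rw [← cdf_monotoneTransport ν κ hz]
    exact monotone_cdf κ h
  · intro h
    rw [monotoneTransport, if_pos hz]
    exact csInf_le (bddBelow_cdf_le κ hz) h

theorem measurable_monotoneTransport : Measurable (monotoneTransport ν κ) := by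
  have hF : Measurable (cdf ν) := (monotone_cdf ν).measurable
  refine measurable_of_Iic fun t => ?_
  have : monotoneTransport ν κ ⁻¹' Iic t =
      ((cdf ν ⁻¹' Ioo 0 1) ∩ {z | cdf ν z ≤ cdf κ t}) ∪ ((cdf ν ⁻¹' Ioo 0 1)ᶜ ∩ {_z | 0 ≤ t}) := by
    ext z
    by_cases hz : cdf ν z ∈ Ioo 0 1
    · have := monotoneTransport_le_iff ν κ hz t
      simp only [mem_preimage, mem_Iic, this, mem_union, mem_inter_iff, mem_compl_iff, hz,
        not_true_eq_false, false_and, or_false, true_and]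
      rfl
    · simp only [mem_preimage, mem_Iic, monotoneTransport, mem_union, mem_inter_iff,
        mem_compl_iff, hz, not_false_eq_true, false_and, false_or, true_and]
      rfl
  rw [this]
  exact ((hF measurableSet_Ioo).inter (measurableSet_le hF measurable_const)).union
    ((hF measurableSet_Ioo).compl.inter (MeasurableSet.const _))

variable [IsProbabilityMeasure ν] [NullSingletonClass ν]

theorem measurePreserving_monotoneTransport :
    MeasurePreserving (monotoneTransport ν κ) ν κ := by
  have hm := measurable_monotoneTransport ν κ
  have := Measure.isProbabilityMeasure_map (μ := ν) hm.aemeasurable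
  refine ⟨hm, Measure.ext_of_Iic _ _ fun t => ?_⟩
  rw [Measure.map_apply hm measurableSet_Iic,
    ← ENNReal.toReal_eq_toReal_iff' (measure_ne_top _ _) (measure_ne_top _ _)]
  change ν.real _ = κ.real _
  rw [← cdf_eq_real, ← measureReal_cdf_le ν (cdf_nonneg κ t) (cdf_le_one κ t)]
  refine congrArg ENNReal.toReal (measure_congr ?_)
  filter_upwards [ae_cdf_mem_Ioo ν] with z hz
  exact propext (monotoneTransport_le_iff ν κ hz t)

/-- Upgrades the one-sided inclusions supplied by monotonicity to equivalences, by comparing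
measures. -/
theorem ae_iff_of_imp {Z : Type*} [MeasurableSpace Z] {ν : Measure Z} [IsFiniteMeasure ν]
    {A B : Set Z} (hA : MeasurableSet A) (h : ∀ᵐ z ∂ν, z ∈ A → z ∈ B)
    (hAB : ν.real B ≤ ν.real A) : ∀ᵐ z ∂ν, z ∈ A ↔ z ∈ B := by
  have : A =ᵐ[ν] B := by
    refine ae_eq_of_ae_subset_of_measure_ge h ?_ hA.nullMeasurableSet (measure_ne_top _ _)
    exact (ENNReal.toReal_le_toReal (measure_ne_top _ _) (measure_ne_top _ _)).1 hAB
  filter_upwards [this] with z hz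
  exact iff_of_eq hz

/-- Where the distribution functions agree, the transport cannot move mass across `t`. This is what
later makes the isomorphism respect labels. -/
theorem monotoneTransport_le_iff_of_cdf_eq {t : ℝ} (ht : cdf ν t = cdf κ t) :
    ∀ᵐ z ∂ν, z ≤ t ↔ monotoneTransport ν κ z ≤ t := by
  refine ae_iff_of_imp (A := Iic t) (B := monotoneTransport ν κ ⁻¹' Iic t) measurableSet_Iic ?_ ?_
  · filter_upwards [ae_cdf_mem_Ioo ν] with z hz h
    change monotoneTransport ν κ z ≤ t
    rw [monotoneTransport_le_iff ν κ hz, ← ht]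
    exact monotone_cdf ν h
  · rw [measureReal_def, (measurePreserving_monotoneTransport ν κ).measure_preimage
      measurableSet_Iic.nullMeasurableSet, ← measureReal_def, ← cdf_eq_real, ← cdf_eq_real, ht]

/-- The round trip never moves a point to the right and preserves `ν`. So it preserves every
rational half-line up to a null set, and must be the identity almost everywhere. -/
theorem ae_monotoneTransport_monotoneTransport :
    ∀ᵐ z ∂ν, monotoneTransport κ ν (monotoneTransport ν κ z) = z := by
  have hp := (measurePreserving_monotoneTransport κ ν).comp
    (measurePreserving_monotoneTransport ν κ)
  have hle : ∀ᵐ z ∂ν, ∀ s, z ≤ s → monotoneTransport κ ν (monotoneTransport ν κ z) ≤ s := by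
    filter_upwards [ae_cdf_mem_Ioo ν] with z hz s hs
    rw [monotoneTransport_le_iff κ ν (by rwa [cdf_monotoneTransport ν κ hz]),
      cdf_monotoneTransport ν κ hz]
    exact monotone_cdf ν hs
  have hq : ∀ᵐ z ∂ν, ∀ q : ℚ,
      z ≤ (q : ℝ) ↔ monotoneTransport κ ν (monotoneTransport ν κ z) ≤ (q : ℝ) := by
    refine ae_all_iff.2 fun q => ae_iff_of_imp (A := Iic (q : ℝ))
      (B := (monotoneTransport κ ν ∘ monotoneTransport ν κ) ⁻¹' Iic (q : ℝ)) measurableSet_Iic ?_ ?_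
    · filter_upwards [hle] with z hz h using hz _ h
    · rw [measureReal_def, hp.measure_preimage measurableSet_Iic.nullMeasurableSet,
        ← measureReal_def]
  filter_upwards [hq] with z hz
  exact eq_of_forall_rat_lt_iff_lt fun q => by simpa using not_congr (hz q).symm

end CDF

/-! ### Label-preserving isomorphism of non-atomic standard spaces -/

section Isomorphism

open ProbabilityTheory

variable {X Z : Type*} [MeasurableSpace X] [StandardBorelSpace X] [MeasurableSpace Z]
  [StandardBorelSpace Z]

/-- Put `x` at its label plus a sigmoid coordinate in (0, 1). The label can then be recovered from
the half-lines that end at integers. -/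
theorem exists_real_embedding {c : X → ℕ} (hc : Measurable c) :
    ∃ ι : X → ℝ, MeasurableEmbedding ι ∧ ∀ x (n : ℕ), ι x ≤ n ↔ c x < n := by
  set s : X → ℝ := fun x => Real.sigmoid (embeddingReal X x) with hs
  have hsm : Measurable s := continuous_sigmoid.measurable.comp (measurable_embeddingReal X)
  have h0 : ∀ x, 0 < s x := fun x => Real.sigmoid_pos _
  have h1 : ∀ x, s x < 1 := fun x => Real.sigmoid_lt_one _
  have hiff : ∀ x (n : ℕ), (c x : ℝ) + s x ≤ n ↔ c x < n := fun x n => by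
    constructor
    · intro h
      exact_mod_cast (by linarith [h0 x] : (c x : ℝ) < n)
    · intro h
      have : (c x : ℝ) + 1 ≤ n := by exact_mod_cast h
      linarith [h1 x]
  refine ⟨fun x => c x + s x, Measurable.measurableEmbedding (by fun_prop) fun x y hxy => ?_, hiff⟩
  have hcc : c x = c y := by
    have hxy : (c x : ℝ) + s x = c y + s y := hxy
    refine le_antisymm ?_ ?_
    · refine Nat.lt_succ_iff.1 ((hiff x _).1 ?_)
      rw [hxy]
      exact (hiff y _).2 (Nat.lt_succ_self _)
    · refine Nat.lt_succ_iff.1 ((hiff y _).1 ?_)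
      rw [← hxy]
      exact (hiff x _).2 (Nat.lt_succ_self _)
  have hss : s x = s y := by
    have hxy : (c x : ℝ) + s x = c y + s y := hxy
    rw [hcc] at hxy
    linarith
  exact (measurableEmbedding_embeddingReal X).injective (Real.sigmoid_injective hss)

omit [StandardBorelSpace X] in
theorem nullSingletonClass_map {μ : Measure X} [NullSingletonClass μ] {Y : Type*}
    [MeasurableSpace Y] [MeasurableSingletonClass Y] {ι : X → Y} (hι : MeasurableEmbedding ι) :
    NullSingletonClass (μ.map ι) := by
  refine ⟨fun y => ?_⟩
  rw [hι.map_apply]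
  exact (Set.subsingleton_singleton.preimage hι.injective).measure_zero μ

variable {μ : Measure X} [IsProbabilityMeasure μ] [NullSingletonClass μ]
  {ν : Measure Z} [IsProbabilityMeasure ν] [NullSingletonClass ν]

/-- Two standard non-atomic probability spaces are isomorphic, and the isomorphism can be chosen
to respect labels with the same distribution. -/
theorem exists_isomorphism {c : X → ℕ} (hc : Measurable c) {d : Z → ℕ} (hd : Measurable d)
    (hcd : μ.map c = ν.map d) :
    ∃ (Φ : Z → X) (Ψ : X → Z), MeasurePreserving Φ ν μ ∧ MeasurePreserving Ψ μ ν ∧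
      (∀ᵐ z ∂ν, Ψ (Φ z) = z) ∧ (∀ᵐ x ∂μ, Φ (Ψ x) = x) ∧ ∀ᵐ z ∂ν, c (Φ z) = d z := by
  have : Nonempty X := μ.nonempty_of_neZero
  have : Nonempty Z := ν.nonempty_of_neZero
  obtain ⟨ι, hι, hιc⟩ := exists_real_embedding hc
  obtain ⟨θ, hθ, hθd⟩ := exists_real_embedding hd
  obtain ⟨j, hj, hjι⟩ := hι.exists_measurable_extend measurable_id (fun _ => inferInstance)
  obtain ⟨k, hk, hkθ⟩ := hθ.exists_measurable_extend measurable_id (fun _ => inferInstance)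
  have hjι : ∀ x, j (ι x) = x := congrFun hjι
  have hkθ : ∀ x, k (θ x) = x := congrFun hkθ
  have := nullSingletonClass_map (μ := μ) hι
  have := nullSingletonClass_map (μ := ν) hθ
  have := Measure.isProbabilityMeasure_map (μ := μ) hι.measurable.aemeasurable
  have := Measure.isProbabilityMeasure_map (μ := ν) hθ.measurable.aemeasurable
  have pι : MeasurePreserving ι μ (μ.map ι) := ⟨hι.measurable, rfl⟩
  have pθ : MeasurePreserving θ ν (ν.map θ) := ⟨hθ.measurable, rfl⟩
  have pj : MeasurePreserving j (μ.map ι) μ := ⟨hj, by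
    rw [Measure.map_map hj hι.measurable, show j ∘ ι = id from funext hjι, Measure.map_id]⟩
  have pk : MeasurePreserving k (ν.map θ) ν := ⟨hk, by
    rw [Measure.map_map hk hθ.measurable, show k ∘ θ = id from funext hkθ, Measure.map_id]⟩
  have aj : ∀ᵐ y ∂(μ.map ι), ι (j y) = y := by
    filter_upwards [hι.ae_map_iff.2 (Eventually.of_forall fun x => Set.mem_range_self x)]
    rintro _ ⟨x, rfl⟩
    rw [hjι]
  have ak : ∀ᵐ y ∂(ν.map θ), θ (k y) = y := by
    filter_upwards [hθ.ae_map_iff.2 (Eventually.of_forall fun x => Set.mem_range_self x)]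
    rintro _ ⟨x, rfl⟩
    rw [hkθ]
  have p1 := measurePreserving_monotoneTransport (ν.map θ) (μ.map ι)
  have p2 := measurePreserving_monotoneTransport (μ.map ι) (ν.map θ)
  have b1 := pθ.quasiMeasurePreserving.ae (p1.quasiMeasurePreserving.ae aj)
  have b2 := pι.quasiMeasurePreserving.ae (p2.quasiMeasurePreserving.ae ak)
  refine ⟨fun z => j (monotoneTransport (ν.map θ) (μ.map ι) (θ z)),
    fun x => k (monotoneTransport (μ.map ι) (ν.map θ) (ι x)),
    pj.comp (p1.comp pθ), pk.comp (p2.comp pι), ?_, ?_, ?_⟩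
  · filter_upwards [b1, pθ.quasiMeasurePreserving.ae
      (ae_monotoneTransport_monotoneTransport (ν.map θ) (μ.map ι))] with z h1 h2
    rw [h1, h2, hkθ]
  · filter_upwards [b2, pι.quasiMeasurePreserving.ae
      (ae_monotoneTransport_monotoneTransport (μ.map ι) (ν.map θ))] with z h1 h2
    rw [h1, h2, hjι]
  -- Equal label distributions make the two distribution functions agree at the integers, so
  -- transport keeps each unit interval, that is, each label.
  · have hcdf : ∀ n : ℕ, cdf (ν.map θ) n = cdf (μ.map ι) n := fun n => by
      rw [cdf_eq_real, cdf_eq_real, map_measureReal_apply hι.measurable measurableSet_Iic,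
        map_measureReal_apply hθ.measurable measurableSet_Iic]
      have e1 : ι ⁻¹' Set.Iic (n : ℝ) = c ⁻¹' Set.Iio n := Set.ext fun x => hιc x n
      have e2 : θ ⁻¹' Set.Iic (n : ℝ) = d ⁻¹' Set.Iio n := Set.ext fun x => hθd x n
      rw [e1, e2, ← map_measureReal_apply hc measurableSet_Iio, hcd,
        map_measureReal_apply hd measurableSet_Iio]
    have h := ae_all_iff.2 fun n : ℕ => pθ.quasiMeasurePreserving.ae
      (monotoneTransport_le_iff_of_cdf_eq (ν.map θ) (μ.map ι) (hcdf n))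
    filter_upwards [b1, h] with z h1 h2
    have h3 : ∀ n : ℕ, c (j (monotoneTransport (ν.map θ) (μ.map ι) (θ z))) < n ↔ d z < n :=
      fun n => by rw [← hιc, h1, ← hθd, h2 n]
    exact le_antisymm (Nat.lt_succ_iff.1 ((h3 _).2 (Nat.lt_succ_self _)))
      (Nat.lt_succ_iff.1 ((h3 _).1 (Nat.lt_succ_self _)))

end Isomorphism

/-! ### Conjugating an extended system back to `X` -/

section Factor

variable {X Z : Type*} [MeasurableSpace X] [MeasurableSpace Z]

/-- A single natural number records which of finitely many sets contain a point, so matching labels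
matches all the sets at once. -/
theorem exists_label {κ : Type*} [Finite κ] {B : κ → Set X} (hB : ∀ k, MeasurableSet (B k)) :
    ∃ c : X → ℕ, Measurable c ∧ ∃ S : κ → Set ℕ, ∀ k, B k = c ⁻¹' S k := by
  obtain ⟨f, hf⟩ := exists_injective_nat (κ → Prop)
  refine ⟨fun x => f fun k => x ∈ B k, ?_, fun k => {n | ∃ p : κ → Prop, f p = n ∧ p k},
    fun k => ?_⟩
  · exact (measurable_of_countable f).comp
      (measurable_pi_iff.2 fun k => measurable_mem.2 (hB k))
  · ext x
    constructor
    · exact fun hx => ⟨_, rfl, hx⟩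
    · rintro ⟨p, hp, hpk⟩
      rwa [hf hp] at hpk

variable [StandardBorelSpace X] [StandardBorelSpace Z] {μ : Measure X} [IsProbabilityMeasure μ]
  [NullSingletonClass μ] {ν : Measure Z} [IsProbabilityMeasure ν] [NullSingletonClass ν]

/-- If `π` almost intertwines `σ` with `T₀`, then a conjugate of `σ` approximates `T₀`, and its
correlations are those of the stationary process `π ∘ σⁿ`. -/
theorem exists_conjugate (T₀ : mpPerm μ) {σ σ' : Z → Z} (hσ : MeasurePreserving σ ν ν)
    (hσ' : MeasurePreserving σ' ν ν) (h1 : ∀ z, σ' (σ z) = z) (h2 : ∀ z, σ (σ' z) = z)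
    {π : Z → X} (hπ : MeasurePreserving π ν μ) {κ : Type*} [Finite κ] {A : κ → Set X}
    (hA : ∀ k, MeasurableSet (A k)) :
    ∃ T : mpPerm μ,
      (∀ k, imageDist (A k) (T : MPAut μ) (T₀ : MPAut μ) ≤
        ν.real {z | π (σ z) ≠ (T₀ : Equiv.Perm X) (π z)}) ∧
      ∀ k l, ∀ n : ℕ, corr (A k) (A l) ((T : MPAut μ) ^ n) =
        ν.real {z | π (σ^[n] z) ∈ A k ∧ π z ∈ A l} := by
  have hA' : ∀ k, MeasurableSet ((T₀ : Equiv.Perm X) '' A k) := fun k =>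
    mpPerm.measurableSet_image T₀ (hA k)
  -- The labels must also record the sets T₀A, because the distance to T₀ compares `T z ∈ T₀A` with
  -- `z ∈ A`.
  obtain ⟨c, hc, S, hS⟩ := exists_label
    (B := Sum.elim A fun k => (T₀ : Equiv.Perm X) '' A k) (by rintro (k | k); exacts [hA k, hA' k])
  obtain ⟨Φ, Ψ, hΦ, hΨ, hΨΦ, hΦΨ, hcΦ⟩ := exists_isomorphism (μ := μ) (ν := ν) hc
    (hc.comp hπ.measurable) (by rw [← Measure.map_map hc hπ.measurable, hπ.map_eq])
  have mem_iff : ∀ᵐ z ∂ν, ∀ k, (Φ z ∈ A k ↔ π z ∈ A k) ∧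
      (Φ z ∈ (T₀ : Equiv.Perm X) '' A k ↔ π z ∈ (T₀ : Equiv.Perm X) '' A k) := by
    filter_upwards [hcΦ] with z hz k
    have e1 : A k = c ⁻¹' S (Sum.inl k) := hS (Sum.inl k)
    have e2 : (T₀ : Equiv.Perm X) '' A k = c ⁻¹' S (Sum.inr k) := hS (Sum.inr k)
    rw [e2, e1, Set.mem_preimage, Set.mem_preimage, Set.mem_preimage, Set.mem_preimage, hz]
    exact ⟨Iff.rfl, Iff.rfl⟩
  obtain ⟨T, hT, -⟩ := exists_mpPerm (μ := μ) (T := fun x => Φ (σ (Ψ x)))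
    (S := fun x => Φ (σ' (Ψ x))) (hΦ.comp (hσ.comp hΨ)) (hΦ.comp (hσ'.comp hΨ)) (by
      filter_upwards [(hσ.comp hΨ).quasiMeasurePreserving.ae hΨΦ, hΦΨ] with x hx hx'
      have hx : Ψ (Φ (σ (Ψ x))) = σ (Ψ x) := hx
      rw [hx, h1, hx']) (by
      filter_upwards [(hσ'.comp hΨ).quasiMeasurePreserving.ae hΨΦ, hΦΨ] with x hx hx'
      have hx : Ψ (Φ (σ' (Ψ x))) = σ' (Ψ x) := hx
      rw [hx, h2, hx'])
  have hTΦ : ∀ᵐ z ∂ν, (T : Equiv.Perm X) (Φ z) = Φ (σ z) := by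
    filter_upwards [hΦ.quasiMeasurePreserving.ae hT, hΨΦ] with z hz hz'
    rw [hz, hz']
  have hTn : ∀ n : ℕ, ∀ᵐ z ∂ν, ((T ^ n : mpPerm μ) : Equiv.Perm X) (Φ z) = Φ (σ^[n] z) := by
    intro n
    induction n with
    | zero => exact Eventually.of_forall fun z => rfl
    | succ n ih =>
      filter_upwards [ih, (hσ.iterate n).quasiMeasurePreserving.ae hTΦ] with z hz hz'
      rw [Function.iterate_succ_apply', ← hz', ← hz, pow_succ']
      rfl
  refine ⟨T, fun k => ?_, fun k l n => ?_⟩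
  -- This rewrites μ(TA Δ T₀A) as μ(T⁻¹T₀A Δ A). Through `Φ`, the two conditions become π(σz) ∈ T₀A
  -- and πz ∈ A, which agree whenever π(σz) = T₀(πz).
  · have e1 := imageDist_inv (hA' k) (T : MPAut μ) T₀
    rw [Set.preimage_image_eq _ (T₀ : Equiv.Perm X).injective] at e1
    rw [← e1, imageDist_inv_mk, Set.preimage_image_eq _ (T₀ : Equiv.Perm X).injective,
      measureReal_def, ← hΦ.measure_preimage
      ((mpPerm.measurable T (hA' k)).symmDiff (hA k)).nullMeasurableSet, ← measureReal_def]
    refine ENNReal.toReal_mono (measure_ne_top _ _) (measure_mono_ae ?_)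
    filter_upwards [hTΦ, mem_iff, hσ.quasiMeasurePreserving.ae mem_iff] with z z1 z2 z3 hz
    intro heq
    have hz : Φ z ∈ ((T : Equiv.Perm X) ⁻¹' ((T₀ : Equiv.Perm X) '' A k)) ∆ A k := hz
    rw [Set.mem_symmDiff, Set.mem_preimage, z1, (z2 k).1, (z3 k).2, heq,
      (T₀ : Equiv.Perm X).injective.mem_set_image] at hz
    tauto
  · rw [← QuotientGroup.mk_pow, corr_mk, measureReal_def, ← hΦ.measure_preimage
      ((mpPerm.measurable (T ^ n) (hA k)).inter (hA l)).nullMeasurableSet, ← measureReal_def]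
    refine congrArg ENNReal.toReal (measure_congr ?_)
    filter_upwards [hTn n, mem_iff, (hσ.iterate n).quasiMeasurePreserving.ae mem_iff]
      with z z1 z2 z3
    refine propext ?_
    change ((T ^ n : mpPerm μ) : Equiv.Perm X) (Φ z) ∈ A k ∧ Φ z ∈ A l ↔ _
    rw [z1, (z2 l).1, (z3 k).1]
    rfl

end Factor

/-! ### Skew read-outs over a finite permutation -/

section FinitePermutation

variable {X : Type*} [MeasurableSpace X] {μ : Measure X} [IsProbabilityMeasure μ]
  {I : Type*} [Fintype I]

/-- The probability measure on a finite set with given weights. -/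
def weightMeasure [MeasurableSpace I] (w : I → ℝ) : Measure I := ∑ i, ENNReal.ofReal (w i) • Measure.dirac i

theorem isProbabilityMeasure_weightMeasure [MeasurableSpace I] {w : I → ℝ} (hw : ∀ i, 0 ≤ w i) (h1 : ∑ i, w i = 1) :
    IsProbabilityMeasure (weightMeasure w) := by
  refine ⟨?_⟩
  simp [weightMeasure, ← ENNReal.ofReal_sum_of_nonneg fun i _ => hw i, h1]

theorem measurePreserving_weightMeasure [MeasurableSpace I] [DiscreteMeasurableSpace I] {w : I → ℝ} {τ : Equiv.Perm I}
    (hτ : ∀ i, w (τ i) = w i) : MeasurePreserving τ (weightMeasure w) (weightMeasure w) := by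
  have hm : Measurable τ := Measurable.of_discrete
  refine ⟨hm, ?_⟩
  ext s hs
  rw [Measure.map_apply hm hs]
  simp only [weightMeasure, Measure.coe_finsetSum, Finset.sum_apply, Measure.smul_apply,
    smul_eq_mul, Measure.dirac_apply]
  refine Fintype.sum_equiv τ _ _ fun i => ?_
  rw [hτ]
  rfl

theorem measureReal_weightMeasure_prod {Y : Type*} [MeasurableSpace Y] {κ : Measure Y}
    [IsProbabilityMeasure κ] [MeasurableSpace I] [MeasurableSingletonClass I] {w : I → ℝ} (hw : ∀ i, 0 ≤ w i)
    {E : Set (I × Y)} (hE : MeasurableSet E) :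
    ((weightMeasure w).prod κ).real E = ∑ i, w i * κ.real (Prod.mk i ⁻¹' E) := by
  rw [measureReal_def, Measure.prod_apply hE, weightMeasure, lintegral_finsetSum_measure]
  simp only [lintegral_smul_measure, lintegral_dirac, smul_eq_mul]
  rw [ENNReal.toReal_sum fun i _ => by finiteness]
  simp [ENNReal.toReal_mul, ENNReal.toReal_ofReal, hw, measureReal_def]

omit [IsProbabilityMeasure μ] in
theorem corr_zpow_sub {A B : Set X} (hA : MeasurableSet A) (hB : MeasurableSet B) (T : mpPerm μ)
    (p q : ℤ) : corr A B ((T : MPAut μ) ^ (p - q)) =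
      μ.real {x | ((T ^ p : mpPerm μ) : Equiv.Perm X) x ∈ A ∧
        ((T ^ q : mpPerm μ) : Equiv.Perm X) x ∈ B} := by
  rw [← QuotientGroup.mk_zpow, corr_mk, measureReal_def,
    ← (T ^ q : mpPerm μ).2.1.measure_preimage
      ((mpPerm.measurable (T ^ (p - q)) hA).inter hB).nullMeasurableSet, ← measureReal_def]
  congr 1
  ext x
  have h : ((T ^ (p - q) : mpPerm μ) : Equiv.Perm X) (((T ^ q : mpPerm μ) : Equiv.Perm X) x) =
      ((T ^ p : mpPerm μ) : Equiv.Perm X) x := by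
    conv_rhs => rw [← sub_add_cancel p q, zpow_add]
    rfl
  change ((T ^ (p - q) : mpPerm μ) : Equiv.Perm X) (((T ^ q : mpPerm μ) : Equiv.Perm X) x) ∈ A ∧
    ((T ^ q : mpPerm μ) : Equiv.Perm X) x ∈ B ↔ _
  rw [h]
  rfl

/-- Approximation of `T₀` by a transformation that permutes finitely many copies of `X × X`. -/
theorem exists_approx_of_perm [StandardBorelSpace X] [NullSingletonClass μ] (T₀ : mpPerm μ)
    {w : I → ℝ} (hw : ∀ i, 0 ≤ w i) (hw1 : ∑ i, w i = 1) {τ : Equiv.Perm I}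
    (hτ : ∀ i, w (τ i) = w i) (e : I → ℤ) (b : I → Bool) {κ : Type*} [Finite κ] {A : κ → Set X}
    (hA : ∀ k, MeasurableSet (A k)) :
    ∃ T : mpPerm μ,
      (∀ k, imageDist (A k) (T : MPAut μ) (T₀ : MPAut μ) ≤
        ∑ i, w i * if b (τ i) = b i ∧ e (τ i) = e i + 1 then 0 else 1) ∧
      ∀ k l, ∀ n : ℕ, corr (A k) (A l) ((T : MPAut μ) ^ n) =
        ∑ i, w i * if b ((τ ^ n) i) = b i then
          corr (A k) (A l) ((T₀ : MPAut μ) ^ (e ((τ ^ n) i) - e i))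
        else μ.real (A k) * μ.real (A l) := by
  classical
  let : MeasurableSpace I := ⊤
  have : DiscreteMeasurableSpace I := ⟨fun _ => trivial⟩
  have := isProbabilityMeasure_weightMeasure hw hw1
  set ρ := weightMeasure w with hρ
  let pr : Bool → X × X → X := fun β p => if β then p.1 else p.2
  have hpr : ∀ β, MeasurePreserving (pr β) (μ.prod μ) μ := fun β => by
    cases β
    · exact measurePreserving_snd
    · exact measurePreserving_fst
  -- The index `i` selects one of two independent points by `b i` and a time `e i`. Every fibre of
  -- the read-out has law `μ`, and it follows T₀ wherever `τ` raises the time by one and keeps the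
  -- selection.
  let π : I × (X × X) → X := fun z => ((T₀ ^ e z.1 : mpPerm μ) : Equiv.Perm X) (pr (b z.1) z.2)
  have hπi : ∀ i, MeasurePreserving (fun p => π (i, p)) (μ.prod μ) μ := fun i =>
    (T₀ ^ e i : mpPerm μ).2.1.comp (hpr (b i))
  have hπm : Measurable π := measurable_from_prod_countable_right fun i => (hπi i).measurable
  have hπ : MeasurePreserving π (ρ.prod (μ.prod μ)) μ := by
    refine ⟨hπm, ?_⟩
    ext B hB
    rw [Measure.map_apply hπm hB,
      ← ENNReal.toReal_eq_toReal_iff' (measure_ne_top _ _) (measure_ne_top _ _),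
      ← measureReal_def, ← measureReal_def, measureReal_weightMeasure_prod hw (hπm hB)]
    have : ∀ i, (μ.prod μ).real (Prod.mk i ⁻¹' (π ⁻¹' B)) = μ.real B := fun i => by
      rw [measureReal_def, measureReal_def, ← (hπi i).measure_preimage hB.nullMeasurableSet]
      rfl
    simp only [this]
    rw [← Finset.sum_mul, hw1, one_mul]
  have hτ' : ∀ i, w (τ.symm i) = w i := fun i => by
    rw [← hτ (τ.symm i), Equiv.apply_symm_apply]
  have hσ := (measurePreserving_weightMeasure hτ).prod (MeasurePreserving.id (μ.prod μ))
  have hσ' := (measurePreserving_weightMeasure hτ').prod (MeasurePreserving.id (μ.prod μ))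
  obtain ⟨T, hT1, hT2⟩ := exists_conjugate T₀ hσ hσ'
    (fun z => Prod.ext (τ.symm_apply_apply _) rfl) (fun z => Prod.ext (τ.apply_symm_apply _) rfl)
    hπ hA
  have hit : ∀ n (z : I × (X × X)), (Prod.map τ id)^[n] z = ((τ ^ n) z.1, z.2) := fun n z => by
    rw [Prod.map_iterate, Function.iterate_id, ← Equiv.Perm.iterate_eq_pow]
    rfl
  refine ⟨T, fun k => (hT1 k).trans ?_, fun k l n => ?_⟩
  · set G : Set I := {i | ¬ (b (τ i) = b i ∧ e (τ i) = e i + 1)} with hG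
    have hsub : {z | π (Prod.map τ id z) ≠ (T₀ : Equiv.Perm X) (π z)} ⊆ G ×ˢ Set.univ := by
      rintro ⟨i, p⟩ hz
      refine ⟨fun hi => hz ?_, trivial⟩
      change ((T₀ ^ e (τ i) : mpPerm μ) : Equiv.Perm X) (pr (b (τ i)) p) =
        (T₀ : Equiv.Perm X) (((T₀ ^ e i : mpPerm μ) : Equiv.Perm X) (pr (b i) p))
      rw [hi.1, hi.2, add_comm, zpow_one_add]
      rfl
    refine (measureReal_mono hsub).trans ?_
    rw [measureReal_weightMeasure_prod hw (MeasurableSet.of_discrete.prod MeasurableSet.univ)]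
    refine Finset.sum_le_sum fun i _ => mul_le_mul_of_nonneg_left ?_ (hw i)
    split_ifs with hi
    · rw [Set.mk_preimage_prod_right_eq_empty (not_not.2 hi), measureReal_empty]
    · exact measureReal_le_one
  · have hE : MeasurableSet {z : I × (X × X) | π ((Prod.map τ id)^[n] z) ∈ A k ∧ π z ∈ A l} :=
      ((hπm.comp (hσ.measurable.iterate n)) (hA k)).inter (hπm (hA l))
    rw [hT2, measureReal_weightMeasure_prod hw hE]
    refine Finset.sum_congr rfl fun i _ => congrArg (w i * ·) ?_
    have hpre : Prod.mk i ⁻¹' {z : I × (X × X) | π ((Prod.map τ id)^[n] z) ∈ A k ∧ π z ∈ A l} =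
        {p | ((T₀ ^ e ((τ ^ n) i) : mpPerm μ) : Equiv.Perm X) (pr (b ((τ ^ n) i)) p) ∈ A k ∧
          ((T₀ ^ e i : mpPerm μ) : Equiv.Perm X) (pr (b i) p) ∈ A l} := by
      ext p
      simp only [Set.mem_preimage, Set.mem_ofPred_eq, hit]
      rfl
    rw [hpre]
    -- If the same coordinate is read twice, invariance leaves only the difference of times; if both
    -- coordinates are read, Fubini factors the measure.
    split_ifs with hb
    · rw [hb, corr_zpow_sub (hA k) (hA l), measureReal_def, measureReal_def,
        ← (hpr (b i)).measure_preimage]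
      · rfl
      · exact ((mpPerm.measurable _ (hA k)).inter (mpPerm.measurable _ (hA l))).nullMeasurableSet
    · set P := ((T₀ ^ e ((τ ^ n) i) : mpPerm μ) : Equiv.Perm X) ⁻¹' A k with hP
      set R := ((T₀ ^ e i : mpPerm μ) : Equiv.Perm X) ⁻¹' A l with hR
      have hPm : μ.real P = μ.real (A k) := mpPerm.measureReal_preimage _ (hA k)
      have hRm : μ.real R = μ.real (A l) := mpPerm.measureReal_preimage _ (hA l)
      rw [← hPm, ← hRm]
      cases hbi : b i <;> cases hbt : b ((τ ^ n) i) <;> rw [hbi, hbt] at hb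
      · exact absurd rfl hb
      · rw [← measureReal_prod_prod]
        rfl
      · rw [mul_comm, ← measureReal_prod_prod]
        congr 1
        ext p
        exact and_comm
      · exact absurd rfl hb

end FinitePermutation

/-! ### Counting on cycles -/

section Cycle

/-- Only the `|j|` positions next to the end of the cycle can wrap around; elsewhere adding `j` mod
`n` is ordinary addition. -/
theorem card_val_add_ne_le {n : ℕ} [NeZero n] (j : ℤ) :
    (Finset.univ.filter fun k : ZMod n => ¬ (((k + j : ZMod n).val : ℤ) = k.val + j)).card ≤
      j.natAbs := by
  have hn : 0 < n := Nat.pos_of_ne_zero (NeZero.ne n)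
  have key : ∀ k : ZMod n, 0 ≤ (k.val : ℤ) + j → (k.val : ℤ) + j < n →
      ((k + j : ZMod n).val : ℤ) = k.val + j := fun k h0 h1 => by
    have : (k + j : ZMod n) = (((k.val : ℤ) + j : ℤ) : ZMod n) := by
      push_cast
      rw [ZMod.natCast_val, ZMod.cast_id', id]
    rw [this, ZMod.val_intCast, Int.emod_eq_of_lt h0 h1]
  have hinj : Set.InjOn (fun k : ZMod n => (k.val : ℤ)) Set.univ := fun x _ y _ h =>
    ZMod.val_injective n (Int.ofNat.inj h)
  rcases le_total 0 j with hj | hj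
  · have hsub : (Finset.univ.filter fun k : ZMod n =>
        ¬ (((k + j : ZMod n).val : ℤ) = k.val + j)).image (fun k : ZMod n => (k.val : ℤ)) ⊆
        Finset.Ico ((n : ℤ) - j) n := by
      intro x hx
      obtain ⟨k, hk, rfl⟩ := Finset.mem_image.1 hx
      have hk := (Finset.mem_filter.1 hk).2
      have := ZMod.val_lt k
      refine Finset.mem_Ico.2 ⟨?_, by exact_mod_cast this⟩
      by_contra hlt
      exact hk (key k (by positivity) (by linarith))
    have := Finset.card_le_card hsub
    rw [Finset.card_image_of_injOn (hinj.mono (Set.subset_univ _)), Int.card_Ico] at this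
    omega
  · have hsub : (Finset.univ.filter fun k : ZMod n =>
        ¬ (((k + j : ZMod n).val : ℤ) = k.val + j)).image (fun k : ZMod n => (k.val : ℤ)) ⊆
        Finset.Ico 0 (-j) := by
      intro x hx
      obtain ⟨k, hk, rfl⟩ := Finset.mem_image.1 hx
      have hk := (Finset.mem_filter.1 hk).2
      have := ZMod.val_lt k
      refine Finset.mem_Ico.2 ⟨by positivity, ?_⟩
      by_contra hlt
      refine hk (key k (by linarith) ?_)
      have : (k.val : ℤ) < n := by exact_mod_cast this
      linarith
    have := Finset.card_le_card hsub
    rw [Finset.card_image_of_injOn (hinj.mono (Set.subset_univ _)), Int.card_Ico] at this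
    omega

theorem not_iff_of_eq_two_mul {m n : ℕ} [NeZero n] (hn : n = 2 * m) (i : ZMod n) :
    ¬ ((i + (m : ZMod n)).val < m ↔ i.val < m) := by
  have h0 : n ≠ 0 := NeZero.ne n
  have hi := ZMod.val_lt i
  rw [ZMod.val_add, ZMod.val_natCast, Nat.mod_eq_of_lt (by omega : m < n)]
  rcases lt_or_ge (i.val + m) n with h | h
  · rw [Nat.mod_eq_of_lt h]
    omega
  · rw [Nat.mod_eq_sub_mod h, Nat.mod_eq_of_lt (by omega)]
    omega

/-- The reason for cycle length m − j: rotating m times is rotating j times. -/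
theorem natCast_eq_intCast_of_toNat {m : ℕ} {j : ℤ} (h : j ≤ m) :
    ((m : ℕ) : ZMod ((m : ℤ) - j).toNat) = (j : ZMod ((m : ℤ) - j).toNat) := by
  have h1 := (ZMod.intCast_eq_intCast_iff_dvd_sub (m : ℤ) j ((m : ℤ) - j).toNat).2
    (by rw [Int.toNat_of_nonneg (by omega)]; exact ⟨-1, by ring⟩)
  rwa [Int.cast_natCast] at h1

/-- The exceptional positions each contribute an error of at most 1, so their proportion bounds the
error of the average. -/
theorem abs_sum_div_sub_le {n : ℕ} [NeZero n] {W : ℝ} (hW : 0 ≤ W) {f : ZMod n → ℝ} {y : ℝ}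
    {P : ZMod n → Prop} [DecidablePred P] (hP : ∀ k, P k → f k = y) (hf : ∀ k, |f k - y| ≤ 1)
    {c : ℕ} (hc : (Finset.univ.filter fun k => ¬ P k).card ≤ c) :
    |∑ k, W / n * f k - W * y| ≤ W * (c / n) := by
  have hn : (0 : ℝ) < n := by exact_mod_cast Nat.pos_of_ne_zero (NeZero.ne n)
  have h1 : ∑ k, W / n * f k - W * y = W / n * ∑ k, (f k - y) := by
    rw [Finset.sum_sub_distrib, ← Finset.mul_sum, Finset.sum_const, Finset.card_univ, ZMod.card,
      nsmul_eq_mul, mul_sub]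
    congr 1
    field_simp
  have h2 : |∑ k, (f k - y)| ≤ c := by
    calc |∑ k, (f k - y)| ≤ ∑ k, |f k - y| := Finset.abs_sum_le_sum_abs _ _
      _ ≤ ∑ k, if ¬ P k then (1 : ℝ) else 0 := Finset.sum_le_sum fun k _ => by
          by_cases h : P k
          · simp [hP k h, h]
          · simpa [h] using hf k
      _ = ((Finset.univ.filter fun k => ¬ P k).card : ℝ) := by
          rw [Finset.sum_boole]
      _ ≤ c := by exact_mod_cast hc
  rw [h1, abs_mul, abs_of_nonneg (by positivity)]
  calc W / n * |∑ k, (f k - y)| ≤ W / n * c := by gcongr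
    _ = W * (c / n) := by ring

end Cycle

/-! ### Transformations near T₀ with prescribed behaviour of one power -/

section Approx

variable {X : Type*} [MeasurableSpace X] {μ : Measure X} [IsProbabilityMeasure μ]

theorem abs_sub_le_one_of_mem {x y : ℝ} (hx : 0 ≤ x ∧ x ≤ 1) (hy : 0 ≤ y ∧ y ≤ 1) :
    |x - y| ≤ 1 := by
  rw [abs_le]; constructor <;> linarith [hx.1, hx.2, hy.1, hy.2]

theorem corr_mem (A B : Set X) (T : MPAut μ) : 0 ≤ corr A B T ∧ corr A B T ≤ 1 :=
  ⟨corr_nonneg _ _ _, corr_le_one _ _ _⟩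

/-- Truncating to `S` and moving the tail weight to Θ changes the value by at most that weight,
since all correlations lie in [0, 1]. -/
theorem Admissible.abs_finset_sub_corr_le (R : Admissible) (S : Finset ℤ) (A B : Set X)
    (T : MPAut μ) :
    |((1 - ∑ j ∈ S, R.coeff j) * (μ.real A * μ.real B) +
        ∑ j ∈ S, R.coeff j * WeakLimits.corr A B (T ^ j)) - R.corr A B T| ≤
      1 - R.a - ∑ j ∈ S, R.coeff j := by
  have hs := R.summable_corr A B T
  have h1 : ∑ j ∈ S, R.coeff j * WeakLimits.corr A B (T ^ j) ≤
      ∑' j, R.coeff j * WeakLimits.corr A B (T ^ j) :=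
    hs.sum_le_tsum S fun j _ => mul_nonneg (R.coeff_nonneg j) (corr_nonneg _ _ _)
  have h2 := (R.hasSum.summable.sub hs).sum_le_tsum S fun j _ =>
    sub_nonneg.2 (mul_le_of_le_one_right (R.coeff_nonneg j) (corr_le_one A B (T ^ j)))
  rw [Finset.sum_sub_distrib, R.hasSum.summable.tsum_sub hs, R.hasSum.tsum_eq] at h2
  have h3 : 0 ≤ μ.real A * μ.real B := by positivity
  have h4 : μ.real A * μ.real B ≤ 1 :=
    mul_le_one₀ measureReal_le_one measureReal_nonneg measureReal_le_one
  have h5 : 0 ≤ 1 - R.a - ∑ j ∈ S, R.coeff j := by linarith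
  have h6 := mul_le_mul_of_nonneg_left h4 h5
  have h7 := mul_nonneg h5 h3
  rw [Admissible.corr, abs_le]
  constructor <;> linarith

/-- The powers of transformations close to `T₀` reach every admissible function of `T₀`. -/
theorem exists_approx [StandardBorelSpace X] [NullSingletonClass μ] (T₀ : mpPerm μ)
    (R : Admissible) {κ : Type*} [Finite κ] {A : κ → Set X} (hA : ∀ k, MeasurableSet (A k))
    {ε : ℝ} (hε : 0 < ε) :
    ∃ m₀ : ℕ, ∀ m ≥ m₀, ∃ T : mpPerm μ,
      (∀ k, imageDist (A k) (T : MPAut μ) (T₀ : MPAut μ) ≤ ε) ∧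
      ∀ k l, |corr (A k) (A l) ((T : MPAut μ) ^ m) - R.corr (A k) (A l) (T₀ : MPAut μ)| ≤ ε := by
  classical
  obtain ⟨S, hS⟩ := ((Metric.tendsto_nhds.1 R.hasSum) (ε / 2) (by positivity)).exists
  rw [Real.dist_eq] at hS
  have hSle : ∑ j ∈ S, R.coeff j ≤ 1 - R.a := by
    rw [← R.hasSum.tsum_eq]
    exact R.hasSum.summable.sum_le_tsum S fun j _ => R.coeff_nonneg j
  set L : ℕ := ∑ j ∈ S, j.natAbs with hL
  have hjL : ∀ j ∈ S, j.natAbs ≤ L := fun j hj =>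
    Finset.single_le_sum (f := Int.natAbs) (fun _ _ => Nat.zero_le _) hj
  -- Every cycle will have length at least `C`. At most `L` positions wrap around under the m-th
  -- power and at most two break the one-step relation, so both proportions are at most ε/2.
  obtain ⟨C, hC⟩ := exists_nat_gt (2 * (L + 2) / ε)
  have hC0 : (0 : ℝ) < C := lt_of_le_of_lt (by positivity) hC
  have hC0' : 0 < C := by exact_mod_cast hC0
  refine ⟨C + L, fun m hm => ?_⟩
  let n : Option S → ℕ := fun s => s.elim (2 * m) fun j => ((m : ℤ) - j).toNat
  have hnC : ∀ s, C ≤ n s := by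
    rintro (_ | j)
    · change C ≤ 2 * m
      omega
    · have := hjL j j.2
      change C ≤ ((m : ℤ) - j).toNat
      omega
  have hn0 : ∀ s, NeZero (n s) := fun s => ⟨(hC0'.trans_le (hnC s)).ne'⟩
  have hfrac : ∀ s (c : ℕ), c ≤ L + 2 → (c : ℝ) / n s ≤ ε / 2 := fun s c hc => by
    have h1 : (C : ℝ) ≤ n s := by exact_mod_cast hnC s
    have h2 : (c : ℝ) ≤ L + 2 := by exact_mod_cast hc
    rw [div_le_iff₀ (hC0.trans_le h1)]
    rw [div_lt_iff₀ hε] at hC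
    nlinarith
  -- The long cycle `none`, which yields Θ, takes the weight `R.a` together with the truncated tail.
  let W : Option S → ℝ := fun s => s.elim (1 - ∑ j ∈ S, R.coeff j) fun j => R.coeff j
  have hW : ∀ s, 0 ≤ W s := by
    rintro (_ | j)
    · change 0 ≤ 1 - ∑ j ∈ S, R.coeff j
      linarith [R.a_nonneg]
    · exact R.coeff_nonneg j
  have hW1 : ∑ s, W s = 1 := by
    rw [Fintype.sum_option]
    change (1 - ∑ j ∈ S, R.coeff j) + ∑ j : S, R.coeff j = 1
    rw [Finset.sum_coe_sort S R.coeff]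
    ring
  let I := Σ s : Option S, ZMod (n s)
  let w : I → ℝ := fun i => W i.1 / n i.1
  let τ : Equiv.Perm I := Equiv.sigmaCongrRight fun s => Equiv.addRight (1 : ZMod (n s))
  have hτ : ∀ (q : ℕ) (i : I), (τ ^ q) i = ⟨i.1, i.2 + q⟩ := fun q i => by
    induction q with
    | zero => simp
    | succ q ih =>
      rw [pow_succ', Equiv.Perm.mul_apply, ih]
      change (⟨i.1, i.2 + q + 1⟩ : I) = _
      push_cast
      rw [add_assoc]
  have hτ1 : ∀ i : I, τ i = ⟨i.1, i.2 + 1⟩ := fun i => rfl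
  let e : I → ℤ := fun i => i.2.val
  -- The coordinate changes only in the long cycle, halfway round; on the other cycles the first one
  -- is always read.
  let b : I → Bool := fun i => decide (i.1 = none → i.2.val < m)
  have hw : ∀ i, 0 ≤ w i := fun i => div_nonneg (hW _) (Nat.cast_nonneg _)
  have hw1 : ∑ i, w i = 1 := by
    rw [Fintype.sum_sigma, ← hW1]
    refine Finset.sum_congr rfl fun s _ => ?_
    have : (n s : ℝ) ≠ 0 := by exact_mod_cast (hn0 s).ne
    change ∑ _k : ZMod (n s), W s / n s = W s
    rw [Finset.sum_const, Finset.card_univ, ZMod.card, nsmul_eq_mul]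
    field_simp
  obtain ⟨T, hT1, hT2⟩ := exists_approx_of_perm T₀ hw hw1 (τ := τ) (fun i => rfl) e b hA
  refine ⟨T, fun k => (hT1 k).trans ?_, fun k l => ?_⟩
  · rw [Fintype.sum_sigma]
    calc _ ≤ ∑ s, W s * ε := Finset.sum_le_sum fun s _ => ?_
      _ = ε := by rw [← Finset.sum_mul, hW1, one_mul]
    -- The one-step relation can fail only at the wrap-around and at the halfway switch from `m - 1`
    -- to `m`.
    set P : ZMod (n s) → Prop := fun k =>
      (((k + (1 : ℤ) : ZMod (n s)).val : ℤ) = k.val + 1) ∧ ¬ (k.val = m - 1) with hP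
    have hcard : (Finset.univ.filter fun k => ¬ P k).card ≤ 2 := by
      have h1 := card_val_add_ne_le (n := n s) 1
      have h2 : (Finset.univ.filter fun k : ZMod (n s) => k.val = m - 1).card ≤ 1 :=
        Finset.card_le_one.2 fun x hx y hy => ZMod.val_injective _
          ((Finset.mem_filter.1 hx).2.trans (Finset.mem_filter.1 hy).2.symm)
      refine (Finset.card_le_card ?_).trans ((Finset.card_union_le _ _).trans (add_le_add h1 h2))
      intro k hk
      have hk := (Finset.mem_filter.1 hk).2
      rw [hP] at hk
      simp only [Finset.mem_union, Finset.mem_filter, Finset.mem_univ, true_and]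
      tauto
    have key := abs_sum_div_sub_le (hW s) (y := 0) (P := P)
      (f := fun k => if b (τ ⟨s, k⟩) = b ⟨s, k⟩ ∧ e (τ ⟨s, k⟩) = e ⟨s, k⟩ + 1 then (0 : ℝ) else 1)
      (fun k hk => if_pos ?_) (fun k => by split_ifs <;> simp) hcard
    · rw [mul_zero, sub_zero] at key
      refine (le_abs_self _).trans (key.trans (mul_le_mul_of_nonneg_left ?_ (hW s)))
      exact (hfrac s 2 (by omega)).trans (by linarith)
    · have hk1 : (k + 1 : ZMod (n s)).val = k.val + 1 := by
        have := hk.1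
        rw [Int.cast_one] at this
        exact_mod_cast this
      rw [hτ1]
      refine ⟨?_, ?_⟩
      · have hk2 := hk.2
        change decide (s = none → (k + 1 : ZMod (n s)).val < m) = decide (s = none → k.val < m)
        rw [hk1]
        refine decide_eq_decide.2 (imp_congr_right fun _ => ?_)
        omega
      · change ((k + 1 : ZMod (n s)).val : ℤ) = k.val + 1
        rw [hk1]
        push_cast
        rfl
  · rw [hT2 k l m, Fintype.sum_sigma]
    set V : Option S → ℝ := fun s => s.elim (μ.real (A k) * μ.real (A l)) fun j =>
      corr (A k) (A l) ((T₀ : MPAut μ) ^ (j : ℤ)) with hV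
    have hVm : ∀ s, 0 ≤ V s ∧ V s ≤ 1 := by
      rintro (_ | j)
      · exact ⟨mul_nonneg measureReal_nonneg measureReal_nonneg, mul_le_one₀ measureReal_le_one measureReal_nonneg
          measureReal_le_one⟩
      · exact corr_mem _ _ _
    have hsum : ∑ s, W s * V s = (1 - ∑ j ∈ S, R.coeff j) * (μ.real (A k) * μ.real (A l)) +
        ∑ j ∈ S, R.coeff j * corr (A k) (A l) ((T₀ : MPAut μ) ^ j) := by
      rw [Fintype.sum_option]
      change (1 - ∑ j ∈ S, R.coeff j) * (μ.real (A k) * μ.real (A l)) +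
        ∑ j : S, R.coeff j * corr (A k) (A l) ((T₀ : MPAut μ) ^ (j : ℤ)) = _
      rw [Finset.sum_coe_sort S fun j => R.coeff j * corr (A k) (A l) ((T₀ : MPAut μ) ^ j)]
    have hfin := R.abs_finset_sub_corr_le S (A k) (A l) (T₀ : MPAut μ)
    rw [← hsum] at hfin
    have hS' : 1 - R.a - ∑ j ∈ S, R.coeff j ≤ ε / 2 := by
      rw [abs_sub_comm] at hS
      exact (le_abs_self _).trans hS.le
    have hmain : |∑ s, (∑ i : ZMod (n s), w ⟨s, i⟩ *
        if b ((τ ^ m) ⟨s, i⟩) = b ⟨s, i⟩ then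
          corr (A k) (A l) ((T₀ : MPAut μ) ^ (e ((τ ^ m) ⟨s, i⟩) - e ⟨s, i⟩))
        else μ.real (A k) * μ.real (A l)) - ∑ s, W s * V s| ≤ ε / 2 := by
      rw [← Finset.sum_sub_distrib]
      refine (Finset.abs_sum_le_sum_abs _ _).trans ?_
      calc _ ≤ ∑ s, W s * (ε / 2) := Finset.sum_le_sum fun s _ => ?_
        _ = ε / 2 := by rw [← Finset.sum_mul, hW1, one_mul]
      have hfm : ∀ i : ZMod (n s), |(if b ((τ ^ m) ⟨s, i⟩) = b ⟨s, i⟩ then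
          corr (A k) (A l) ((T₀ : MPAut μ) ^ (e ((τ ^ m) ⟨s, i⟩) - e ⟨s, i⟩))
        else μ.real (A k) * μ.real (A l)) - V s| ≤ 1 := fun i => by
        refine abs_sub_le_one_of_mem ?_ (hVm s)
        split_ifs
        · exact corr_mem _ _ _
        · exact hVm none
      rcases s with _ | j
      · refine (abs_sum_div_sub_le (hW none) (P := fun _ => True) (c := 0)
          (fun i _ => if_neg ?_) hfm (by simp)).trans
            (mul_le_mul_of_nonneg_left (hfrac none 0 (by omega)) (hW none))
        rw [hτ]
        simpa [b] using not_iff_of_eq_two_mul (n := n none) rfl i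
      · have hcard := card_val_add_ne_le (n := n (some j)) (j : ℤ)
        refine (abs_sum_div_sub_le (hW (some j)) (fun i hi => ?_) hfm hcard).trans
          (mul_le_mul_of_nonneg_left
            (hfrac (some j) _ ((hjL j j.2).trans (by omega))) (hW (some j)))
        have hmj : ((m : ℕ) : ZMod (n (some j))) = ((j : ℤ) : ZMod (n (some j))) := by
          refine natCast_eq_intCast_of_toNat ?_
          have := hjL j j.2
          omega
        rw [hτ, if_pos (by simp [b])]
        change corr (A k) (A l) ((T₀ : MPAut μ) ^
          (((i + (m : ZMod (n (some j)))).val : ℤ) - (i.val : ℤ))) =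
            corr (A k) (A l) ((T₀ : MPAut μ) ^ (j : ℤ))
        rw [hmj, hi]
        congr 2
        ring
    calc _ ≤ _ := abs_sub_le _ (∑ s, W s * V s) _
      _ ≤ ε / 2 + ε / 2 := add_le_add hmain (hfin.trans hS')
      _ = ε := by ring

end Approx

/-! ### Koopman operators and tests for weak convergence -/

section Koopman

variable {X : Type*} [MeasurableSpace X] {μ : Measure X}

theorem norm_koopman_apply (T : MPAut μ) (f : L2 μ) : ‖koopman T f‖ = ‖f‖ := by
  induction T using Quotient.inductionOn' with | h T => ?_
  exact Lp.norm_compMeasurePreserving f (mpPerm.measurePreserving T)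

theorem norm_koopman_le (T : MPAut μ) : ‖koopman T‖ ≤ 1 :=
  ContinuousLinearMap.opNorm_le_bound _ zero_le_one fun f => by
    rw [norm_koopman_apply, one_mul]

theorem koopman_one : koopman (1 : MPAut μ) = ContinuousLinearMap.id ℂ (L2 μ) := by
  ext1 f
  exact Lp.compMeasurePreserving_id_apply f

theorem koopman_mul_apply (S T : MPAut μ) (f : L2 μ) :
    koopman (S * T) f = koopman T (koopman S f) := by
  induction S using Quotient.inductionOn' with | h S => ?_
  induction T using Quotient.inductionOn' with | h T => ?_
  exact Lp.compMeasurePreserving_comp_apply f (mpPerm.measurePreserving S)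
    (mpPerm.measurePreserving T)

theorem inner_koopman_koopman (T : MPAut μ) (f g : L2 μ) :
    inner ℂ (koopman T f) (koopman T g) = inner ℂ f g := by
  induction T using Quotient.inductionOn' with | h T => ?_
  exact (Lp.compMeasurePreservingₗᵢ ℂ (T : Equiv.Perm X)
    (mpPerm.measurePreserving T)).inner_map_map f g

variable [IsProbabilityMeasure μ]

/-- The indicator function of a set as an element of `L₂`. -/
def ind (μ : Measure X) [IsProbabilityMeasure μ] {A : Set X} (hA : MeasurableSet A) : L2 μ :=
  indicatorConstLp 2 hA (measure_ne_top μ A) 1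

theorem inner_ind_ind {A B : Set X} (hA : MeasurableSet A) (hB : MeasurableSet B) :
    inner ℂ (ind μ hA) (ind μ hB) = (μ.real (A ∩ B) : ℂ) :=
  L2.inner_indicatorConstLp_one_indicatorConstLp_one hA hB

theorem inner_ind_koopman {A B : Set X} (hA : MeasurableSet A) (hB : MeasurableSet B)
    (T : MPAut μ) : inner ℂ (ind μ hB) (koopman T (ind μ hA)) = (corr A B T : ℂ) := by
  induction T using Quotient.inductionOn' with | h T => ?_
  have h : koopman (Quotient.mk'' T) (ind μ hA) = ind μ (mpPerm.measurable T hA) :=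
    Lp.indicatorConstLp_compMeasurePreserving hA _ _ (mpPerm.measurePreserving T)
  rw [h, inner_ind_ind, Set.inter_comm]
  rfl

theorem const_eq_ind : Lp.const 2 μ (1 : ℂ) = ind μ MeasurableSet.univ :=
  (indicatorConstLp_univ 2 μ (1 : ℂ)).symm

theorem meanProj_apply (f : L2 μ) :
    meanProj μ f = inner ℂ (ind μ MeasurableSet.univ) f • ind μ MeasurableSet.univ := by
  simp only [meanProj, const_eq_ind]
  refine Submodule.starProjection_unit_singleton ℂ ?_ f
  rw [← const_eq_ind]
  exact (Lp.norm_const (p := 2) (μ := μ) (c := (1 : ℂ)) two_ne_zero).trans (by simp)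

theorem inner_ind_meanProj {A B : Set X} (hA : MeasurableSet A) (hB : MeasurableSet B) :
    inner ℂ (ind μ hB) (meanProj μ (ind μ hA)) = ((μ.real A * μ.real B : ℝ) : ℂ) := by
  rw [meanProj_apply, inner_smul_right, inner_ind_ind, inner_ind_ind, Set.univ_inter,
    Set.inter_univ]
  push_cast
  rfl

omit [IsProbabilityMeasure μ] in
theorem Admissible.summable_eval (R : Admissible) (T : MPAut μ) :
    Summable fun i : ℤ => (R.coeff i : ℂ) • koopman (T ^ i) := by
  refine Summable.of_norm_bounded R.hasSum.summable fun i => ?_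
  rw [norm_smul, Complex.norm_real, Real.norm_of_nonneg (R.coeff_nonneg i)]
  exact mul_le_of_le_one_right (R.coeff_nonneg i) (norm_koopman_le _)

theorem Admissible.inner_ind_eval (R : Admissible) {A B : Set X} (hA : MeasurableSet A)
    (hB : MeasurableSet B) (T : MPAut μ) :
    inner ℂ (ind μ hB) (R.eval T (ind μ hA)) = (R.corr A B T : ℂ) := by
  have h1 := ((R.summable_eval T).hasSum.mapL
    ((ContinuousLinearMap.apply ℂ (L2 μ) (ind μ hA)))).mapL (innerSL ℂ (ind μ hB))
  have h2 : (fun i : ℤ => innerSL ℂ (ind μ hB) ((ContinuousLinearMap.apply ℂ (L2 μ) (ind μ hA))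
      ((R.coeff i : ℂ) • koopman (T ^ i)))) =
      fun i => ((R.coeff i * WeakLimits.corr A B (T ^ i) : ℝ) : ℂ) := by
    funext i
    simp [inner_ind_koopman]
  rw [h2] at h1
  have h3 := h1.tsum_eq
  rw [← Complex.ofReal_tsum] at h3
  rw [Admissible.eval, _root_.add_apply, inner_add_right,
    _root_.smul_apply, inner_smul_right, inner_ind_meanProj, Admissible.corr]
  rw [Complex.ofReal_add, Complex.ofReal_mul, Complex.ofReal_mul, Complex.ofReal_mul, h3]
  rfl

/-- Indicators of arbitrary measurable sets are L₂-limits of those in the dense family, and their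
closed linear span is everything. -/
theorem mem_of_ind_mem (D : DenseFamily μ) {P : Submodule ℂ (L2 μ)} (hP : IsClosed (P : Set (L2 μ)))
    (h : ∀ i, ind μ (D.measurableSet i) ∈ P) (f : L2 μ) : f ∈ P := by
  refine Lp.induction (by norm_num) (motive := fun f => f ∈ P) (fun c A hA _ => ?_)
    (fun _ _ _ _ _ hf hg => P.add_mem hf hg) hP f
  have hAP : ind μ hA ∈ P := by
    choose i hi using fun n : ℕ => D.dense A hA (1 / (n + 1)) Nat.one_div_pos_of_nat
    have ht : Tendsto (fun n => μ (D.set (i n) ∆ A)) atTop (𝓝 0) := by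
      rw [← ENNReal.tendsto_toReal_iff (fun _ => measure_ne_top _ _) ENNReal.zero_ne_top]
      exact squeeze_zero (fun _ => measureReal_nonneg) (fun n => (hi n).le)
        tendsto_one_div_add_atTop_nhds_zero_nat
    exact hP.mem_of_tendsto (tendsto_indicatorConstLp_set (ht := fun n => D.measurableSet (i n))
      (hμt := fun n => measure_ne_top _ _) (by norm_num) ht) (Eventually.of_forall fun n => h (i n))
  rw [Lp.simpleFunc.coe_indicatorConst]
  have hc : indicatorConstLp 2 hA (measure_ne_top μ A) c = c • ind μ hA := by
    refine Lp.ext ?_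
    filter_upwards [indicatorConstLp_coeFn (p := 2) (hs := hA) (hμs := measure_ne_top μ A) (c := c),
      indicatorConstLp_coeFn (p := 2) (hs := hA) (hμs := measure_ne_top μ A) (c := (1 : ℂ)),
      Lp.coeFn_smul c (ind μ hA)] with x h1 h2 h3
    rw [h1, h3, Pi.smul_apply, ind, h2]
    by_cases hx : x ∈ A <;> simp [hx]
  rw [hc]
  exact P.smul_mem c hAP

/-- A Lipschitz constant common to all indices lets a limit point inherit convergence from a nearby
vector. -/
theorem isClosed_tendsto_zero {E ι : Type*} [SeminormedAddCommGroup E] {l : Filter ι}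
    {φ : ι → E → ℂ} {K : ℝ} (hφ : ∀ a x y, ‖φ a x - φ a y‖ ≤ K * ‖x - y‖) :
    IsClosed {x | Tendsto (fun a => φ a x) l (𝓝 0)} := by
  refine isClosed_of_closure_subset fun x hx => ?_
  rw [Set.mem_ofPred_eq, Metric.tendsto_nhds]
  intro ε hε
  have hK : 0 < |K| + 1 := by positivity
  obtain ⟨y, hy, hxy⟩ := Metric.mem_closure_iff.1 hx (ε / 2 / (|K| + 1)) (by positivity)
  filter_upwards [Metric.tendsto_nhds.1 hy (ε / 2) (by positivity)] with a ha
  rw [dist_zero_right] at ha ⊢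
  rw [dist_eq_norm, lt_div_iff₀ hK] at hxy
  have h1 := hφ a x y
  have h2 : K * ‖x - y‖ ≤ ‖x - y‖ * (|K| + 1) := by
    nlinarith [le_abs_self K, norm_nonneg (x - y)]
  have h3 := norm_le_norm_sub_add (φ a x) (φ a y)
  linarith

/-- Weak convergence of uniformly bounded operators can be tested on indicators. -/
theorem tendsto_inner_of_ind (D : DenseFamily μ) {ι : Type*} {l : Filter ι}
    {V : ι → L2 μ →L[ℂ] L2 μ} {K : ℝ} (hV : ∀ a, ‖V a‖ ≤ K)
    (h : ∀ i j, Tendsto (fun a => inner ℂ (ind μ (D.measurableSet j))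
      (V a (ind μ (D.measurableSet i)))) l (𝓝 0)) (f g : L2 μ) :
    Tendsto (fun a => inner ℂ g (V a f)) l (𝓝 0) := by
  -- Density is used in one variable at a time: the second argument stays an indicator until `f` is
  -- arbitrary.
  have step : ∀ j (f : L2 μ), Tendsto (fun a => inner ℂ (ind μ (D.measurableSet j)) (V a f)) l
      (𝓝 0) := by
    intro j
    let P : Submodule ℂ (L2 μ) :=
      { carrier := {f | Tendsto (fun a => inner ℂ (ind μ (D.measurableSet j)) (V a f)) l (𝓝 0)}
        zero_mem' := by simpa using tendsto_const_nhds
        add_mem' := fun {f g} hf hg => by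
          simpa [inner_add_right] using Tendsto.add (f := fun a => inner ℂ _ (V a f))
            (g := fun a => inner ℂ _ (V a g)) hf hg
        smul_mem' := fun c f hf => by
          simpa [inner_smul_right] using Tendsto.const_mul c
            (f := fun a => inner ℂ _ (V a f)) hf }
    refine mem_of_ind_mem D (P := P) (isClosed_tendsto_zero (K := ‖ind μ (D.measurableSet j)‖ * K)
      fun a x y => ?_) fun i => h i j
    rw [← inner_sub_right, ← map_sub]
    refine (norm_inner_le_norm _ _).trans ?_
    rw [mul_assoc]
    gcongr
    exact (V a).le_of_opNorm_le (hV a) _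
  let P : Submodule ℂ (L2 μ) :=
    { carrier := {g | Tendsto (fun a => inner ℂ g (V a f)) l (𝓝 0)}
      zero_mem' := by simpa using tendsto_const_nhds
      add_mem' := fun {g k} hg hk => by
        simpa [inner_add_left] using Tendsto.add (f := fun a => inner ℂ g (V a f))
          (g := fun a => inner ℂ k (V a f)) hg hk
      smul_mem' := fun c g hg => by
        simpa [inner_smul_left] using Tendsto.const_mul ((starRingEnd ℂ) c)
          (f := fun a => inner ℂ g (V a f)) hg }
  refine mem_of_ind_mem D (P := P) (isClosed_tendsto_zero (K := K * ‖f‖)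
    fun a x y => ?_) (fun j => step j f) g
  rw [← inner_sub_left]
  refine (norm_inner_le_norm _ _).trans ?_
  rw [mul_comm]
  gcongr
  exact (V a).le_of_opNorm_le (hV a) _

theorem Admissible.weakLimitAlong_of_corr (R : Admissible) (D : DenseFamily μ) {M : Set ℕ}
    {T : MPAut μ} (h : ∀ i j, Tendsto (fun m : ℕ => WeakLimits.corr (D.set i) (D.set j) (T ^ m))
      (atTop ⊓ 𝓟 M) (𝓝 (R.corr (D.set i) (D.set j) T))) : WeakLimitAlong M T (R.eval T) := by
  rw [WeakLimitAlong, ContinuousLinearMapWOT.tendsto_iff_forall_inner_apply_tendsto]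
  intro f g
  have key := tendsto_inner_of_ind D (l := atTop ⊓ 𝓟 M)
    (V := fun m : ℕ => koopman (T ^ m) - R.eval T) (K := 1 + ‖R.eval T‖)
    (fun m => (norm_sub_le _ _).trans (add_le_add_left (norm_koopman_le _) _)) (fun i j => ?_) f g
  · have := key.add_const (inner ℂ g (R.eval T f))
    simpa [inner_sub_right] using this
  · have h1 := (Complex.continuous_ofReal.tendsto _).comp
      ((h i j).sub_const (R.corr (D.set i) (D.set j) T))
    rw [sub_self, Complex.ofReal_zero] at h1
    refine h1.congr fun m => ?_
    rw [_root_.sub_apply, inner_sub_right, inner_ind_koopman, R.inner_ind_eval]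
    simp

omit [IsProbabilityMeasure μ] in
theorem WeakLimitAlong.unique {M : Set ℕ} (hM : M.Infinite) {T : MPAut μ}
    {V W : L2 μ →L[ℂ] L2 μ} (hV : WeakLimitAlong M T V) (hW : WeakLimitAlong M T W) : V = W := by
  have : (atTop ⊓ 𝓟 M : Filter ℕ).NeBot := by
    rw [← Filter.frequently_mem_iff_neBot]
    exact Nat.frequently_atTop_iff_infinite.2 hM
  exact ContinuousLinearMapWOT.ofCLM_injective (tendsto_nhds_unique hV hW)

omit [IsProbabilityMeasure μ] in
theorem WeakLimitAlong.mono {M M' : Set ℕ} (h : M' ⊆ M) {T : MPAut μ} {V : L2 μ →L[ℂ] L2 μ}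
    (hV : WeakLimitAlong M T V) : WeakLimitAlong M' T V :=
  Tendsto.mono_left hV (inf_le_inf_left _ (principal_mono.2 h))

end Koopman

/-! ### Baire category -/

section Generic

variable {X : Type*} [MeasurableSpace X] [StandardBorelSpace X] {μ : Measure X}
  [IsProbabilityMeasure μ] [NullSingletonClass μ]

/-- The transformations some power `Tᵐ` of which, with `m ∈ M` and `m ≥ k`, is close to `R(T)` on
the first sets of a dense family. -/
def nearPowers (D : DenseFamily μ) (R : Admissible) (M : Set ℕ) (k : ℕ) : Set (MPAut μ) :=
  {T | ∃ m ∈ M, k ≤ m ∧ ∀ i ≤ k, ∀ j ≤ k,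
    |corr (D.set i) (D.set j) (T ^ m) - R.corr (D.set i) (D.set j) T| < 1 / (k + 1)}

omit [NullSingletonClass μ] in
theorem isOpen_nearPowers (D : DenseFamily μ) (R : Admissible) (M : Set ℕ) (k : ℕ) :
    letI := halmosMetric D; IsOpen (nearPowers D R M k) := by
  let := halmosMetric D
  have : nearPowers D R M k = ⋃ m ∈ {m | m ∈ M ∧ k ≤ m}, ⋂ i ∈ Set.Iic k, ⋂ j ∈ Set.Iic k,
      {T | |corr (D.set i) (D.set j) (T ^ m) - R.corr (D.set i) (D.set j) T| < 1 / (k + 1)} := by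
    ext T
    simp [nearPowers, and_assoc]
  rw [this]
  refine isOpen_biUnion fun m _ => (Set.finite_Iic k).isOpen_biInter fun i _ =>
    (Set.finite_Iic k).isOpen_biInter fun j _ => isOpen_lt ?_ continuous_const
  have h1 := (continuous_corr D (D.measurableSet i) (D.measurableSet j)).comp
    (continuous_halmos_pow D m)
  have h2 := R.continuous_corr D (D.measurableSet i) (D.measurableSet j)
  exact (h1.sub h2).abs

/-- Approximants from `exists_approx` of increasing accuracy converge to T₀. Their powers imitate
R(T₀), and continuity of `R.corr` replaces R(T₀) by R evaluated at the approximant itself. -/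
theorem dense_nearPowers (D : DenseFamily μ) (R : Admissible) {M : Set ℕ} (hM : M.Infinite)
    (k : ℕ) : letI := halmosMetric D; Dense (nearPowers D R M k) := by
  let := halmosMetric D
  intro T
  induction T using Quotient.inductionOn' with | h T₀ => ?_
  have hex : ∀ n : ℕ, ∃ m ∈ M, n ≤ m ∧ ∃ T : mpPerm μ,
      (∀ i ≤ n, imageDist (D.set i) (T : MPAut μ) (T₀ : MPAut μ) ≤ 1 / (n + 1)) ∧
      ∀ i ≤ n, ∀ j ≤ n, |corr (D.set i) (D.set j) ((T : MPAut μ) ^ m) -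
        R.corr (D.set i) (D.set j) (T₀ : MPAut μ)| ≤ 1 / (n + 1) := fun n => by
    obtain ⟨m₀, hm₀⟩ := exists_approx T₀ R (κ := Fin (n + 1)) (A := fun i => D.set i)
      (fun i => D.measurableSet i) (ε := 1 / (n + 1)) Nat.one_div_pos_of_nat
    obtain ⟨m, hmM, hm⟩ := hM.exists_gt (max m₀ n)
    obtain ⟨T, hT1, hT2⟩ := hm₀ m ((le_max_left _ _).trans hm.le)
    exact ⟨m, hmM, (le_max_right _ _).trans hm.le, T,
      fun i hi => hT1 ⟨i, Nat.lt_succ_of_le hi⟩,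
      fun i hi j hj => hT2 ⟨i, Nat.lt_succ_of_le hi⟩ ⟨j, Nat.lt_succ_of_le hj⟩⟩
  choose m hmM hm u hu1 hu2 using hex
  have hlim : Tendsto (fun n => (u n : MPAut μ)) atTop (𝓝 (T₀ : MPAut μ)) := by
    refine tendsto_halmos D fun i => ?_
    refine squeeze_zero' (Eventually.of_forall fun _ => imageDist_nonneg _ _ _) ?_
      (tendsto_one_div_add_atTop_nhds_zero_nat (𝕜 := ℝ))
    filter_upwards [eventually_ge_atTop i] with n hn using hu1 n i hn
  refine mem_closure_of_tendsto hlim ?_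
  have hev : ∀ᶠ n : ℕ in atTop, ∀ i ∈ Finset.range (k + 1), ∀ j ∈ Finset.range (k + 1),
      1 / ((n : ℝ) + 1) + |R.corr (D.set i) (D.set j) (u n : MPAut μ) -
        R.corr (D.set i) (D.set j) (T₀ : MPAut μ)| < 1 / (k + 1) := by
    refine (Filter.eventually_all_finset _).2 fun i _ =>
      (Filter.eventually_all_finset _).2 fun j _ => ?_
    have h1 := ((R.continuous_corr D (D.measurableSet i) (D.measurableSet j)).tendsto
      (T₀ : MPAut μ)).comp hlim
    have h2 := (tendsto_one_div_add_atTop_nhds_zero_nat (𝕜 := ℝ)).add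
      (h1.sub_const (R.corr (D.set i) (D.set j) (T₀ : MPAut μ))).abs
    rw [sub_self, abs_zero, add_zero] at h2
    exact h2.eventually_lt_const Nat.one_div_pos_of_nat
  filter_upwards [hev, eventually_ge_atTop k] with n hn hkn
  refine ⟨m n, hmM n, hkn.trans (hm n), fun i hi j hj => ?_⟩
  have h1 := hu2 n i (hi.trans hkn) j (hj.trans hkn)
  have h2 := hn i (Finset.mem_range.2 (Nat.lt_succ_of_le hi)) j
    (Finset.mem_range.2 (Nat.lt_succ_of_le hj))
  rw [abs_sub_comm (R.corr _ _ _)] at h2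
  exact (abs_sub_le _ _ _).trans_lt ((add_le_add_left h1 _).trans_lt h2)

omit [StandardBorelSpace X] [NullSingletonClass μ] in
theorem exists_weakLimitAlong (D : DenseFamily μ) (R : Admissible) {M : Set ℕ} {T : MPAut μ}
    (hT : ∀ k, T ∈ nearPowers D R M k) :
    ∃ M' ⊆ M, M'.Infinite ∧ WeakLimitAlong M' T (R.eval T) := by
  choose m hmM hm h using hT
  refine ⟨Set.range m, Set.range_subset_iff.2 hmM,
    Set.infinite_of_forall_exists_gt fun a => ⟨m (a + 1), Set.mem_range_self _, hm (a + 1)⟩,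
    R.weakLimitAlong_of_corr D fun i j => ?_⟩
  rw [Metric.tendsto_nhds]
  intro ε hε
  obtain ⟨K₀, hK₀⟩ := exists_nat_one_div_lt hε
  set K := max K₀ (max i j) with hK
  rw [eventually_inf_principal]
  -- The sum exceeds or equals each `m k` with `k < K`, so a value of `m` beyond it has index at
  -- least `K`; no monotonicity of `m` is needed.
  filter_upwards [eventually_gt_atTop (∑ k ∈ Finset.range K, m k)]
  rintro _ hx ⟨k, rfl⟩
  have hkK : K ≤ k := by
    by_contra hlt
    exact not_le.2 hx (Finset.single_le_sum (f := m) (fun _ _ => Nat.zero_le _)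
      (Finset.mem_range.2 (not_le.1 hlt)))
  rw [Real.dist_eq]
  refine (h k i (by omega) j (by omega)).trans_le (le_trans ?_ hK₀.le)
  exact Nat.one_div_le_one_div (by omega)

theorem isGeneric_exists_weakLimitAlong (D : DenseFamily μ) (R : Admissible) {M : Set ℕ}
    (hM : M.Infinite) :
    IsGeneric D {T : MPAut μ | ∃ M' ⊆ M, M'.Infinite ∧ WeakLimitAlong M' T (R.eval T)} := by
  let := halmosMetric D
  have := completeSpace_halmos D
  exact ⟨⋂ k, nearPowers D R M k,
    fun T hT => exists_weakLimitAlong D R fun k => Set.mem_iInter.1 hT k,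
    IsGδ.iInter_of_isOpen fun k => isOpen_nearPowers D R M k,
    dense_iInter_of_isOpen_nat (fun k => isOpen_nearPowers D R M k)
      fun k => dense_nearPowers D R hM k⟩

omit [NullSingletonClass μ] in
theorem IsGeneric.mono {D : DenseFamily μ} {s t : Set (MPAut μ)} (hs : IsGeneric D s)
    (hst : s ⊆ t) : IsGeneric D t := by
  obtain ⟨W, hW, h⟩ := hs
  exact ⟨W, hW.trans hst, h⟩

/-- The admissible function `κ Θ + (1 - κ) I`. -/
def Admissible.kappa (κ : ℝ) (h0 : 0 ≤ κ) (h1 : κ ≤ 1) : Admissible where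
  a := κ
  coeff := Pi.single 0 (1 - κ)
  a_nonneg := h0
  coeff_nonneg i := by by_cases h : i = 0 <;> simp [h, h1]
  hasSum := hasSum_pi_single 0 (1 - κ)

omit [StandardBorelSpace X] [NullSingletonClass μ] in
theorem Admissible.kappa_eval (κ : ℝ) (h0 : 0 ≤ κ) (h1 : κ ≤ 1) (T : MPAut μ) :
    (Admissible.kappa κ h0 h1).eval T =
      (κ : ℂ) • meanProj μ + ((1 - κ : ℝ) : ℂ) • ContinuousLinearMap.id ℂ (L2 μ) := by
  rw [Admissible.eval, tsum_eq_single 0, zpow_zero, koopman_one]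
  · simp [Admissible.kappa]
  · intro i hi
    simp [Admissible.kappa, Pi.single_eq_of_ne hi]

theorem exists_measureReal_eq_half (μ : Measure X) [IsProbabilityMeasure μ]
    [NullSingletonClass μ] : ∃ A : Set X, MeasurableSet A ∧ μ.real A = 1 / 2 := by
  have hι := measurableEmbedding_embeddingReal X
  have := nullSingletonClass_map (μ := μ) hι
  have := Measure.isProbabilityMeasure_map (μ := μ) hι.measurable.aemeasurable
  have hm : MeasurableSet {z | ProbabilityTheory.cdf (μ.map (embeddingReal X)) z ≤ 1 / 2} :=
    (isClosed_le (continuous_cdf _) continuous_const).measurableSet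
  refine ⟨_, hι.measurable hm, ?_⟩
  rw [← map_measureReal_apply hι.measurable hm]
  exact measureReal_cdf_le _ (by norm_num) (by norm_num)

/-- A set of measure 1/2 separates them: its indicator has quadratic form 1/4 under Θ and 1/2 under
the identity. -/
theorem meanProj_ne_id : meanProj μ ≠ ContinuousLinearMap.id ℂ (L2 μ) := by
  intro h
  obtain ⟨A, hA, hA2⟩ := exists_measureReal_eq_half μ
  have h1 := inner_ind_meanProj (μ := μ) hA hA
  rw [h, ContinuousLinearMap.id_apply, inner_ind_ind, Set.inter_self, hA2] at h1
  have h2 : (1 / 2 : ℝ) = 1 / 2 * (1 / 2) := by exact_mod_cast h1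
  norm_num at h2

theorem isGeneric_weakLimitAlong_id (D : DenseFamily μ) {M : Set ℕ} (hM : M.Infinite) :
    IsGeneric D {T : MPAut μ | ∃ M' ⊆ M, M'.Infinite ∧
      WeakLimitAlong M' T (ContinuousLinearMap.id ℂ (L2 μ))} := by
  refine (isGeneric_exists_weakLimitAlong D (Admissible.kappa 0 le_rfl zero_le_one) hM).mono
    fun T hT => ?_
  simpa [Admissible.kappa_eval] using hT

theorem isGeneric_weakLimitAlong_meanProj (D : DenseFamily μ) {M : Set ℕ} (hM : M.Infinite) :
    IsGeneric D {T : MPAut μ | ∃ M' ⊆ M, M'.Infinite ∧ WeakLimitAlong M' T (meanProj μ)} := by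
  refine (isGeneric_exists_weakLimitAlong D (Admissible.kappa 1 zero_le_one le_rfl) hM).mono
    fun T hT => ?_
  simpa [Admissible.kappa_eval] using hT

omit [NullSingletonClass μ] in
theorem IsGeneric.mem_residual {D : DenseFamily μ} {s : Set (MPAut μ)} (hs : IsGeneric D s) :
    letI := halmosMetric D; s ∈ residual (MPAut μ) := by
  let := halmosMetric D
  have := completeSpace_halmos D
  exact _root_.mem_residual.2 hs

/-- The powers along a fixed sequence converge only on a set of first category. -/
theorem isFirstCategory_weakLimitAlong (D : DenseFamily μ) (Q : Admissible) {M : Set ℕ}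
    (hM : M.Infinite) : IsFirstCategory D {T : MPAut μ | WeakLimitAlong M T (Q.eval T)} := by
  let := halmosMetric D
  have h1 := (isGeneric_weakLimitAlong_id D hM).mem_residual
  have h2 := (isGeneric_weakLimitAlong_meanProj D hM).mem_residual
  refine Filter.mem_of_superset (Filter.inter_mem h1 h2) ?_
  -- A limit along all of `M` would have to equal both subsequence limits, the identity and Θ.
  rintro T ⟨⟨M₁, hM₁, hi₁, hl₁⟩, ⟨M₂, hM₂, hi₂, hl₂⟩⟩ hT
  have hT : WeakLimitAlong M T (Q.eval T) := hT
  exact meanProj_ne_id (((hT.mono hM₂).unique hi₂ hl₂).symm.trans ((hT.mono hM₁).unique hi₁ hl₁))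

end Generic

/-! ### Weak mixing from a single weak limit Θ -/

section WeakMixing

/-- An infinite family of bounded vectors that become orthogonal to each other contains large
finite almost orthogonal families. -/
theorem exists_finset_almost_orthogonal {E : Type*} [NormedAddCommGroup E] [InnerProductSpace ℂ E]
    {y : ℕ → E} {M : Set ℕ} (hM : M.Infinite)
    (h : ∀ k, Tendsto (fun m => inner ℂ (y m) (y k)) (atTop ⊓ 𝓟 M) (𝓝 0)) {δ : ℝ} (hδ : 0 < δ)
    (K : ℕ) : ∃ s : Finset ℕ, s.card = K ∧
      ∀ k ∈ s, ∀ l ∈ s, k ≠ l → ‖(inner ℂ (y k) (y l) : ℂ)‖ ≤ δ := by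
  induction K with
  | zero => exact ⟨∅, rfl, by simp⟩
  | succ K ih =>
    obtain ⟨s, hs, hsδ⟩ := ih
    have hev : ∀ᶠ m in atTop ⊓ 𝓟 M, ∀ k ∈ s, ‖(inner ℂ (y m) (y k) : ℂ)‖ ≤ δ := by
      refine (Filter.eventually_all_finset _).2 fun k _ => ?_
      filter_upwards [Metric.tendsto_nhds.1 (h k) δ hδ] with m hm
      rw [dist_zero_right] at hm
      exact hm.le
    have hne : (atTop ⊓ 𝓟 M : Filter ℕ).NeBot :=
      Filter.frequently_mem_iff_neBot.1 (Nat.frequently_atTop_iff_infinite.2 hM)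
    have hgt : ∀ᶠ m in atTop ⊓ 𝓟 M, ∑ k ∈ s, k < m :=
      (eventually_gt_atTop _).filter_mono inf_le_left
    obtain ⟨m, hm, hms⟩ := (hev.and hgt).exists
    have hmem : m ∉ s := fun hmem =>
      not_le.2 hms (Finset.single_le_sum (f := id) (fun _ _ => Nat.zero_le _) hmem)
    refine ⟨insert m s, by rw [Finset.card_insert_of_notMem hmem, hs], fun k hk l hl hkl => ?_⟩
    rcases Finset.mem_insert.1 hk with rfl | hk'
    · rcases Finset.mem_insert.1 hl with rfl | hl'
      · exact absurd rfl hkl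
      · exact hm l hl'
    · rcases Finset.mem_insert.1 hl with rfl | hl'
      · rw [norm_inner_symm]
        exact hm k hk'
      · exact hsδ k hk' l hl' hkl

/-- Rotating each `y k` by a phase turns the sum into one inner product of `x` with a vector `v`.
Expanding ‖v‖², `hcard` absorbs the diagonal and almost orthogonality bounds the rest. -/
theorem sum_norm_inner_le {E : Type*} [NormedAddCommGroup E] [InnerProductSpace ℂ E]
    {y : ℕ → E} {G η : ℝ} (hη : 0 ≤ η) {s : Finset ℕ} (hG : ∀ k, ‖y k‖ ≤ G)
    (hs : ∀ k ∈ s, ∀ l ∈ s, k ≠ l → ‖(inner ℂ (y k) (y l) : ℂ)‖ ≤ η ^ 2 / 2)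
    (hcard : G ^ 2 ≤ s.card * (η ^ 2 / 2)) (x : E) :
    ∑ k ∈ s, ‖(inner ℂ x (y k) : ℂ)‖ ≤ ‖x‖ * (s.card * η) := by
  have hc : ∀ z : ℂ, ∃ c : ℂ, ‖c‖ ≤ 1 ∧ c * z = ‖z‖ := fun z => by
    rcases eq_or_ne z 0 with rfl | hz
    · exact ⟨0, by simp, by simp⟩
    · have hz' : (‖z‖ : ℂ) ≠ 0 := by simpa using hz
      refine ⟨(starRingEnd ℂ) z / ‖z‖, by simp [hz], ?_⟩
      rw [div_mul_eq_mul_div, Complex.conj_mul', sq]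
      field_simp
  choose c hc1 hc2 using fun k => hc (inner ℂ x (y k))
  set v := ∑ k ∈ s, c k • y k with hv
  have h1 : ((∑ k ∈ s, ‖(inner ℂ x (y k) : ℂ)‖ : ℝ) : ℂ) = inner ℂ x v := by
    rw [hv, inner_sum]
    push_cast
    exact Finset.sum_congr rfl fun k _ => by rw [inner_smul_right, hc2]
  have h2 : ‖v‖ ^ 2 ≤ (s.card * η) ^ 2 := by
    have e1 : (‖v‖ ^ 2 : ℝ) = ‖(inner ℂ v v : ℂ)‖ := by
      rw [inner_self_eq_norm_sq_to_K]
      simp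
    rw [e1, hv, sum_inner]
    calc ‖∑ k ∈ s, (inner ℂ (c k • y k) (∑ l ∈ s, c l • y l) : ℂ)‖
        ≤ ∑ k ∈ s, (s.card * η ^ 2 : ℝ) := by
          refine norm_sum_le_of_le _ fun k hk => ?_
          rw [inner_sum]
          refine (norm_sum_le_of_le (f := fun l => inner ℂ (c k • y k) (c l • y l))
            (n := fun l => if k = l then G ^ 2 else η ^ 2 / 2) _ fun l hl => ?_).trans ?_
          · rw [inner_smul_left, inner_smul_right, norm_mul, norm_mul, RCLike.norm_conj]
            have hle : ‖(inner ℂ (y k) (y l) : ℂ)‖ ≤ if k = l then G ^ 2 else η ^ 2 / 2 := by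
              split_ifs with hkl
              · refine (norm_inner_le_norm _ _).trans ?_
                rw [sq]
                exact mul_le_mul (hG k) (hG l) (norm_nonneg _) ((norm_nonneg _).trans (hG k))
              · exact hs k hk l hl hkl
            calc ‖c k‖ * (‖c l‖ * ‖(inner ℂ (y k) (y l) : ℂ)‖)
                ≤ 1 * (1 * ‖(inner ℂ (y k) (y l) : ℂ)‖) := by
                  gcongr
                  · exact hc1 k
                  · exact hc1 l
              _ ≤ _ := by rw [one_mul, one_mul]; exact hle
          · calc ∑ l ∈ s, (if k = l then G ^ 2 else η ^ 2 / 2)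
                ≤ ∑ l ∈ s, ((if k = l then G ^ 2 else 0) + η ^ 2 / 2) :=
                  Finset.sum_le_sum fun l _ => by
                    split_ifs
                    · linarith [sq_nonneg η]
                    · linarith
              _ = G ^ 2 + s.card * (η ^ 2 / 2) := by
                  rw [Finset.sum_add_distrib, Finset.sum_ite_eq, if_pos hk, Finset.sum_const,
                    nsmul_eq_mul]
              _ ≤ s.card * η ^ 2 := by linarith
      _ = (s.card * η) ^ 2 := by
          rw [Finset.sum_const, nsmul_eq_mul]
          ring
  have h3 : ‖v‖ ≤ s.card * η := (sq_le_sq₀ (norm_nonneg _) (by positivity)).1 h2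
  calc ∑ k ∈ s, ‖(inner ℂ x (y k) : ℂ)‖
      ≤ ‖((∑ k ∈ s, ‖(inner ℂ x (y k) : ℂ)‖ : ℝ) : ℂ)‖ := by
        rw [Complex.norm_real]
        exact le_abs_self _
    _ = ‖(inner ℂ x v : ℂ)‖ := by rw [h1]
    _ ≤ ‖x‖ * ‖v‖ := norm_inner_le_norm _ _
    _ ≤ _ := by gcongr

/-- Weak convergence to zero along a subsequence of a unitary orbit forces Cesàro convergence of
the absolute values of the correlations. -/
theorem tendsto_average_norm_inner {E : Type*} [NormedAddCommGroup E] [InnerProductSpace ℂ E]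
    {x y : ℕ → E} {F G : ℝ} (hF : ∀ n, ‖x n‖ ≤ F) (hG : ∀ n, ‖y n‖ ≤ G)
    (hxy : ∀ n k, (inner ℂ (x (n + k)) (y 0) : ℂ) = inner ℂ (x n) (y k)) {M : Set ℕ}
    (hM : M.Infinite) (h : ∀ k, Tendsto (fun m => inner ℂ (y m) (y k)) (atTop ⊓ 𝓟 M) (𝓝 0)) :
    Tendsto (fun N : ℕ => (N : ℝ)⁻¹ * ∑ n ∈ Finset.range N, ‖(inner ℂ (x n) (y 0) : ℂ)‖) atTop
      (𝓝 0) := by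
  have hF0 : 0 ≤ F := (norm_nonneg _).trans (hF 0)
  have hG0 : 0 ≤ G := (norm_nonneg _).trans (hG 0)
  rw [Metric.tendsto_nhds]
  intro ε hε
  -- Chosen so that F η < ε/2; the added 1 avoids division by zero when F = 0.
  set η := ε / (2 * (F + 1)) with hη
  have hη0 : 0 < η := by positivity
  have hFη : F * η < ε / 2 + 0 := by
    rw [hη, add_zero, mul_div_assoc', div_lt_iff₀ (by positivity)]
    nlinarith
  obtain ⟨K, hK⟩ := exists_nat_gt (G ^ 2 / (η ^ 2 / 2))
  have hK0 : (0 : ℝ) < K := lt_of_le_of_lt (by positivity) hK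
  rw [div_lt_iff₀ (by positivity)] at hK
  obtain ⟨s, hsK, hs⟩ := exists_finset_almost_orthogonal hM h (δ := η ^ 2 / 2) (by positivity) K
  set a : ℕ → ℝ := fun n => ‖(inner ℂ (x n) (y 0) : ℂ)‖ with ha
  have ha0 : ∀ n, 0 ≤ a n := fun n => norm_nonneg _
  have haC : ∀ n, a n ≤ F * G := fun n =>
    (norm_inner_le_norm _ _).trans (mul_le_mul (hF n) (hG 0) (norm_nonneg _) hF0)
  -- Shifting time by `k` costs only `k` boundary terms, which averaging removes. This allows
  -- averaging over the almost orthogonal `y k`, `k ∈ s`, as well.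
  have hshift : ∀ N k : ℕ, ∑ n ∈ Finset.range N, a n ≤
      ∑ n ∈ Finset.range N, ‖(inner ℂ (x n) (y k) : ℂ)‖ + k * (F * G) := fun N k => by
    have e1 : ∑ n ∈ Finset.range N, a n ≤ ∑ n ∈ Finset.range (k + N), a n :=
      Finset.sum_le_sum_of_subset_of_nonneg (Finset.range_mono (by omega)) fun n _ _ => ha0 n
    rw [Finset.sum_range_add] at e1
    have e2 : ∑ n ∈ Finset.range k, a n ≤ k * (F * G) := by
      refine (Finset.sum_le_card_nsmul _ _ (F * G) fun n _ => haC n).trans ?_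
      rw [Finset.card_range, nsmul_eq_mul]
    have e3 : ∑ n ∈ Finset.range N, a (k + n) =
        ∑ n ∈ Finset.range N, ‖(inner ℂ (x n) (y k) : ℂ)‖ :=
      Finset.sum_congr rfl fun n _ => by rw [ha, ← hxy, add_comm]
    linarith
  set L : ℝ := ∑ k ∈ s, (k : ℝ) * (F * G) with hL
  have hbound : ∀ N : ℕ, K * ∑ n ∈ Finset.range N, a n ≤ N * (F * (K * η)) + L := fun N => by
    have e1 := Finset.sum_le_sum fun k (_ : k ∈ s) => hshift N k
    rw [Finset.sum_const, hsK, nsmul_eq_mul, Finset.sum_add_distrib, Finset.sum_comm] at e1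
    have e2 : ∑ n ∈ Finset.range N, ∑ k ∈ s, ‖(inner ℂ (x n) (y k) : ℂ)‖ ≤
        N * (F * (K * η)) := by
      refine (Finset.sum_le_card_nsmul _ _ (F * (K * η)) fun n _ => ?_).trans ?_
      · refine (sum_norm_inner_le hη0.le hG hs (by rw [hsK]; exact hK.le) (x n)).trans ?_
        rw [hsK]
        exact mul_le_mul_of_nonneg_right (hF n) (by positivity)
      · rw [Finset.card_range, nsmul_eq_mul]
    linarith
  have hlim : Tendsto (fun N : ℕ => L / K * (N : ℝ)⁻¹) atTop (𝓝 0) := by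
    simpa using tendsto_inv_atTop_nhds_zero_nat.const_mul (L / K)
  filter_upwards [hlim.eventually_lt_const (half_pos hε), eventually_gt_atTop 0] with N hN hN0
  have hN' : (0 : ℝ) < N := by exact_mod_cast hN0
  rw [Real.dist_0_eq_abs, abs_of_nonneg
    (mul_nonneg (by positivity) (Finset.sum_nonneg fun n _ => ha0 n))]
  have e1 : ∑ n ∈ Finset.range N, a n ≤ N * (F * η) + L / K := by
    have := hbound N
    rw [← le_div_iff₀' hK0] at this
    refine this.trans (le_of_eq ?_)
    field_simp
  calc (N : ℝ)⁻¹ * ∑ n ∈ Finset.range N, a n ≤ (N : ℝ)⁻¹ * (N * (F * η) + L / K) := by gcongr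
    _ = F * η + L / K * (N : ℝ)⁻¹ := by field_simp
    _ < ε := by linarith

variable {X : Type*} [MeasurableSpace X] {μ : Measure X} [IsProbabilityMeasure μ]

theorem koopman_ind_univ (T : MPAut μ) :
    koopman T (ind μ MeasurableSet.univ) = ind μ MeasurableSet.univ := by
  induction T using Quotient.inductionOn' with | h T => ?_
  exact Lp.indicatorConstLp_compMeasurePreserving MeasurableSet.univ _ _
    (mpPerm.measurePreserving T)

theorem inner_koopman_meanProj (T : MPAut μ) (f g : L2 μ) :
    inner ℂ (koopman T f) (meanProj μ g) = inner ℂ (meanProj μ f) g := by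
  have h1 := inner_koopman_koopman T f (ind μ MeasurableSet.univ)
  rw [koopman_ind_univ] at h1
  rw [meanProj_apply, meanProj_apply, inner_smul_right, inner_smul_left, h1, inner_conj_symm,
    mul_comm]

theorem meanProj_meanProj (f : L2 μ) : meanProj μ (meanProj μ f) = meanProj μ f := by
  have h : inner ℂ (ind μ MeasurableSet.univ) (ind μ MeasurableSet.univ) = (1 : ℂ) := by
    rw [inner_ind_ind]
    simp
  rw [meanProj_apply f, map_smul, meanProj_apply, h, one_smul]

/-- A transformation with `Θ` as a weak limit of its powers is weakly mixing. -/
theorem isWeakMixing_of_weakLimitAlong {T : MPAut μ} {M : Set ℕ} (hM : M.Infinite)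
    (hT : WeakLimitAlong M T (meanProj μ)) : IsWeakMixing T := by
  intro f g
  set g' := g - meanProj μ g with hg'
  -- With the mean removed, ⟨Tⁿf, g'⟩ is exactly the difference of correlations in the definition of
  -- weak mixing.
  have hΘ : meanProj μ g' = 0 := by rw [hg', map_sub, meanProj_meanProj, sub_self]
  have key := tendsto_average_norm_inner (x := fun n => koopman (T ^ n) f)
    (y := fun k => koopman (T ^ (-k : ℤ)) g') (fun n => (norm_koopman_apply _ f).le)
    (fun k => (norm_koopman_apply _ g').le) (fun n k => ?_) hM (fun k => ?_)
  · refine key.congr fun N => congrArg _ (Finset.sum_congr rfl fun n _ => ?_)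
    simp only [Nat.cast_zero, neg_zero, zpow_zero, koopman_one, ContinuousLinearMap.id_apply]
    rw [hg', inner_sub_right, inner_koopman_meanProj]
  · change inner ℂ (koopman (T ^ (n + k)) f) (koopman (T ^ (-(0 : ℕ) : ℤ)) g') = _
    rw [← inner_koopman_koopman (T ^ k) (koopman (T ^ n) f), ← koopman_mul_apply,
      ← koopman_mul_apply, ← pow_add]
    congr 2
    simp
  · rw [WeakLimitAlong, ContinuousLinearMapWOT.tendsto_iff_forall_inner_apply_tendsto] at hT
    -- Applying the isometry of Tᵐ⁺ᵏ turns ⟨T⁻ᵐg', T⁻ᵏg'⟩ into ⟨Tᵏg', Tᵐg'⟩, which tends to ⟨Tᵏg',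
    -- Θg'⟩ = 0.
    have h1 := hT g' (koopman (T ^ k) g')
    have h2 : inner ℂ (koopman (T ^ k) g') (ContinuousLinearMapWOT.ofCLM (meanProj μ) g') =
        (0 : ℂ) := by
      rw [ContinuousLinearMapWOT.ofCLM_apply, hΘ, inner_zero_right]
    rw [h2] at h1
    refine h1.congr fun m => ?_
    rw [ContinuousLinearMapWOT.ofCLM_apply, ← inner_koopman_koopman (T ^ (m + k))
      (koopman (T ^ (-m : ℤ)) g'), ← koopman_mul_apply, ← koopman_mul_apply]
    have e1 : T ^ (-m : ℤ) * T ^ (m + k) = T ^ k := by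
      rw [pow_add, ← mul_assoc]
      simp
    have e2 : T ^ (-k : ℤ) * T ^ (m + k) = T ^ m := by
      rw [add_comm, pow_add, ← mul_assoc]
      simp
    rw [e1, e2]

end WeakMixing

end WeakLimits

end

theorem mainTheorem6 {X : Type*} [MeasurableSpace X] [StandardBorelSpace X]
    (μ : Measure X) [IsProbabilityMeasure μ] [NullSingletonClass μ] (D : WeakLimits.DenseFamily μ) :
    (∀ M : Set ℕ, M.Infinite → ∀ Q R : WeakLimits.Admissible,
      WeakLimits.IsGeneric D
        {T : WeakLimits.MPAut μ | ∃ M' ⊆ M, M'.Infinite ∧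
          WeakLimits.WeakLimitAlong M' T (R.eval T)} ∧
      WeakLimits.IsFirstCategory D
        {T : WeakLimits.MPAut μ | WeakLimits.WeakLimitAlong M T (Q.eval T)}) ∧
    WeakLimits.IsGeneric D {T : WeakLimits.MPAut μ | WeakLimits.IsWeakMixing T} ∧
    WeakLimits.IsGeneric D {T : WeakLimits.MPAut μ | ¬ WeakLimits.IsMixing T} ∧
    (∀ κ : ℝ, 0 ≤ κ → κ ≤ 1 →
      WeakLimits.IsGeneric D {T : WeakLimits.MPAut μ | WeakLimits.IsKappaMixing κ T}) := by
  open WeakLimits in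
  refine ⟨fun M hM Q R => ⟨isGeneric_exists_weakLimitAlong D R hM,
    isFirstCategory_weakLimitAlong D Q hM⟩, ?_, ?_, fun κ h0 h1 => ?_⟩
  · refine (isGeneric_weakLimitAlong_meanProj D Set.infinite_univ).mono ?_
    rintro T ⟨M, -, hM, hT⟩
    exact isWeakMixing_of_weakLimitAlong hM hT
  · refine (isGeneric_weakLimitAlong_id D Set.infinite_univ).mono ?_
    rintro T ⟨M, -, hM, hT⟩ hmix
    exact meanProj_ne_id (((WeakLimitAlong.mono (Set.subset_univ M) hmix).unique hM hT))
  · refine (isGeneric_exists_weakLimitAlong D (Admissible.kappa κ h0 h1) Set.infinite_univ).mono ?_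
    rintro T ⟨M, -, hM, hT⟩
    rw [Admissible.kappa_eval] at hT
    exact ⟨M, hM, hT⟩
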